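/- **Setting.** Let $e\ge 1$, let $R=\mathbb Z[\mathrm e^{2\pi \mathrm i/e}]$ and let $E\cong Z_e$ be the subgroup of order $e$ of $R^\times$. Let $\bar\ell=\ell^a$ and $\bar\ell'=\ell'^{a'}$ ($a,a'\ge 1$) be powers of primes $\ell,\ell'$ with $e\mid \ell-1$ and $e\mid\ell'-1$ (these are the admissible prime powers), and fix surjective ring homomorphisms $R\to\mathbb Z/\bar\ell$ and $R\to\mathbb Z/\bar\ell'$, which are injective on $E$. Let $E$ act through them on $Z_{\bar\ell}=\mathbb Z/\bar\ell$ and $Z_{\bar\ell'}=\mathbb Z/\bar\ell'$, and put $G_1=Z_{\bar\ell}\rtimes E$, $G_2=Z_{\bar\ell'}\rtimes E$. Let $k,k'$ be fields of characteristics $\ell,\ell'$. The simple $kG_1$-modules $T_1,\dots,T_e$ are labelled so that $T_1$ is trivial and the first $e$ radical layers of the projective cover $\mathcal P(T_1)$ are $T_1,\dots,T_e$; equivalently, $T_i$ is the reduction of the ordinary character $\zeta\mapsto\zeta^{i-1}$ of $E$. The simple $k'G_2$-modules $T'_1,\dots,T'_e$ are labelled in the same way, and $T_i$ and $T_i'$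 (hence also $\mathcal P(T_i)$ and $\mathcal P(T'_i)$) are *identified*. For $1\le\alpha,\beta\le e$ let $U_{\alpha,\beta}$ be the uniserial $kG_1$-module with $\beta$ layers and socle $T_\alpha$, put $U_{\alpha,0}=0$, and define $U'_{\alpha,\beta}$ similarly for $k'G_2$; $U_{\alpha,\beta}$ and $U'_{\alpha,\beta}$ are identified. **The algorithm.** Let $\pi:\{1,\dots,e\}\to\mathbb Z_{\ge0}$ be any function. Applied to $(kG_1,\pi)$ the algorithm returns complexes $X_1,\dots,X_e$, with $X_i$ concentrated in degrees $-\pi(i),\dots,0$, as follows. Put $L_{\pi(i)+1}=T_i$. For $j=\pi(i),\pi(i)-1,\dots,1$, the term in degree $-j$ is the injective hull $P_j$ of $L_{j+1}$; $M_j$ is the largest submodule of $P_j$ containing $L_{j+1}$ such that all composition factors of $M_j/L_{j+1}$ are among the $T_\alpha$ with $\pi(\alpha)<j$; and $L_j=P_j/M_j$. The term in degree $0$ is $L_1$, and the differentials are the compositions $P_j\to L_j\hookrightarrow P_{j-1}$ and $P_1\to L_1$. Let $X'_1,\dots,X'_e$ be the complexes returned for $(k'G_2,\pi)$. The algorithm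 is *generic for $(E,\pi)$ with lower bound $m$* if, for all admissible $\bar\ell,\bar\ell'\ge m$ as above and all $i$, (1) for $1\le j\le\pi(i)$ the projective modules in degree $-j$ of $X_i$ and $X_i'$ are identified, and (2) for every $j\ge0$ the multisets of composition factors of $H^{-j}(X_i)$ and $H^{-j}(X'_i)$ are equal up to identification. **Proposition.** For every $e\ge1$ and every $\pi:\{1,\dots,e\}\to\mathbb Z_{\ge0}$, the algorithm is generic for $(E,\pi)$ with lower bound $0$. More precisely, for all $\bar\ell,\bar\ell',k,k'$ as above the labellings $T_i$, $T_i'$ and the complexes $X_i$, $X'_i$ exist, and for all $1\le i\le e$: 1. for $1\le j\le\pi(i)$ there is an $\alpha\in\{1,\dots,e\}$ such that the terms in degree $-j$ of $X_i$ and of $X'_i$ are $\mathcal P(T_\alpha)$ and $\mathcal P(T'_\alpha)$ respectively; 2. for every $j\ge0$ there are $1\le\alpha\le e$ and $0\le\beta\le e$ such that $H^{-j}(X_i)\cong U_{\alpha,\beta}$ and $H^{-j}(X'_i)\cong U'_{\alpha,\beta}$; 3. writing $A_i$ and $A_i'$ for the terms in degree $0$ of $X_i$ and $X'_i$: if $\pi(i)$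 is even, there are $1\le\alpha,\beta\le e$ with $A_i\cong U_{\alpha,\beta}$ and $A'_i\cong U'_{\alpha,\beta}$; if $\pi(i)$ is odd, there are $1\le\alpha,\beta\le e$ with $\Omega(A_i)\cong U_{\alpha,\beta}$ and $\Omega(A'_i)\cong U'_{\alpha,\beta}$, where $\Omega$ denotes the kernel of a projective cover. -/

import Mathlib

open CategoryTheory

noncomputable section

namespace PerverseAlg

/-! ### Modules over a ring -/

section Modules

universe u v

variable {A : Type u} [Ring A]

/-- For submodules `K`, `K'` of `N` (used for `K ≤ K'`), the subquotient `K' / K`. -/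
abbrev Subquot {N : Type*} [AddCommGroup N] [Module A N] (K K' : Submodule A N) : Type _ :=
  (↥K') ⧸ (K.submoduleOf K')

/-- `f : Q → M` is a projective cover: `Q` is projective, `f` is onto and `ker f` is superfluous. -/
structure IsProjectiveCover {Q M : Type*} [AddCommGroup Q] [Module A Q] [AddCommGroup M]
    [Module A M] (f : Q →ₗ[A] M) : Prop where
  projective : Module.Projective A Q
  surjective : Function.Surjective f
  superfluous : ∀ K : Submodule A Q, K ⊔ LinearMap.ker f = ⊤ → K = ⊤

/-- `Q` is an injective hull of its submodule `L`: `Q` is injective and `L` is essential in `Q`. -/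
structure IsInjectiveHull {Q : Type v} [AddCommGroup Q] [Module A Q] (L : Submodule A Q) :
    Prop where
  injective : Module.Injective A Q
  essential : ∀ K : Submodule A Q, K ⊓ L = ⊥ → K = ⊥

/-- `W` is (isomorphic to) `Ω(M)`, the kernel of a projective cover of `M`. -/
def IsOmega (M W : ModuleCat.{v} A) : Prop :=
  ∃ (Q : ModuleCat.{v} A) (f : Q →ₗ[A] M), IsProjectiveCover f ∧
    Nonempty (W ≃ₗ[A] ↥(LinearMap.ker f))

/-- The socle: the sum of all simple submodules. -/
def socle (N : Type*) [AddCommGroup N] [Module A N] : Submodule A N :=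
  sSup {S : Submodule A N | IsSimpleModule A S}

/-- The radical series `rad^r N`: `rad^0 N = N`, and `rad^(r+1) N` is the radical (intersection
of the maximal submodules) of `rad^r N`. -/
def radPow (N : Type*) [AddCommGroup N] [Module A N] : ℕ → Submodule A N
  | 0 => ⊤
  | r + 1 => (Module.jacobson A ↥(radPow N r)).map (radPow N r).subtype

/-- The submodules of `N` form a chain. -/
def IsUniserial (A : Type*) [Ring A] (N : Type*) [AddCommGroup N] [Module A N] : Prop :=
  ∀ K K' : Submodule A N, K ≤ K' ∨ K' ≤ K

variable {ι : Type*} (T : ι → ModuleCat.{v} A)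

/-- `N` is the uniserial module `U_{α,β}`: uniserial with `β` layers and (if `β ≠ 0`) socle
isomorphic to `T α`. For `β = 0` this says that `N` is zero. -/
structure IsU (α : ι) (β : ℕ) (N : Type*) [AddCommGroup N] [Module A N] : Prop where
  uniserial : IsUniserial A N
  length_eq : Module.length A N = β
  socle_iso : β ≠ 0 → Nonempty (↥(socle (A := A) N) ≃ₗ[A] T α)

/-- Every composition factor (simple subquotient) of `N` is one of the `T α` with `p α`. -/
def FactorsIn (p : ι → Prop) (N : Type*) [AddCommGroup N] [Module A N] : Prop :=
  ∀ K K' : Submodule A N, K ≤ K' → IsSimpleModule A (Subquot K K') →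
    ∃ α, p α ∧ Nonempty (Subquot K K' ≃ₗ[A] T α)

/-- `m` is the multiset of (labels of the) composition factors of `N`, for a family `T` of
pairwise non-isomorphic simple modules: `N` has a composition series whose factors are the
`T α` for `α` in `m`. -/
def HasCompositionFactors (m : Multiset ι) (N : Type*) [AddCommGroup N] [Module A N] : Prop :=
  ∃ (r : ℕ) (F : Fin (r + 1) → Submodule A N) (c : Fin r → ι),
    F 0 = ⊥ ∧ F (Fin.last r) = ⊤ ∧
    (∀ t : Fin r, F t.castSucc ≤ F t.succ ∧
      Nonempty (Subquot (F t.castSucc) (F t.succ) ≃ₗ[A] T (c t))) ∧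
    m = Finset.univ.val.map c

/-- `Q` is isomorphic to the projective module `⨁ α, P(T α) ^ (n α)`, i.e. it is a projective
cover of `⨁ α, (T α) ^ (n α)` (`ι` finite). -/
def IsProjectiveOfType (n : ι → ℕ) (Q : Type*) [AddCommGroup Q] [Module A Q] : Prop :=
  ∃ f : Q →ₗ[A] ((α : ι) → Fin (n α) → T α), IsProjectiveCover f

/-- `M` is the largest submodule of `P` containing `L` such that all composition factors of
`M / L` are among the `T α` with `p α`. -/
def IsLargestExtension (p : ι → Prop) {P : Type*} [AddCommGroup P] [Module A P]
    (L M : Submodule A P) : Prop :=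
  IsGreatest {M' : Submodule A P | L ≤ M' ∧ FactorsIn T p (Subquot L M')} M

/-- `X` is the complex `X_i` returned by the algorithm for the simple modules `T` and the perversity
function `π` (with no relatively projective modules prescribed).

* `X` lives in degrees `-π(i), …, 0`; if `π(i) = 0` it is `T i` in degree `0`.
* The term in degree `-π(i)` (if `π(i) > 0`) is the injective hull of `T i`, and the kernel
  `M_{π(i)}` of the differential out of it is the largest submodule containing `T i` for which
  `M_{π(i)} / T i` has only composition factors `T α` with `π(α) < π(i)`.
* For `0 < j < π(i)`, the term in degree `-j` is the injective hull of the image `L_{j+1}` of the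
  previous differential, and the kernel `M_j` of the next differential is the largest
  submodule containing `L_{j+1}` for which `M_j / L_{j+1}` has only composition factors `T α`
  with `π(α) < j`.
* The term in degree `0` (if `π(i) > 0`) is `L_1`, the quotient of the term in degree `-1` by
  `M_1`: the last differential is onto. -/
structure IsAlgorithmOutput (π : ι → ℕ) (i : ι) (X : CochainComplex (ModuleCat.{v} A) ℤ) :
    Prop where
  isZero : ∀ n : ℤ, n < -(π i : ℤ) ∨ 0 < n → Limits.IsZero (X.X n)
  trivial : π i = 0 → Nonempty (X.X 0 ≃ₗ[A] T i)
  first : 0 < π i → ∃ s : T i →ₗ[A] X.X (-(π i : ℤ)), Function.Injective s ∧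
    IsInjectiveHull (LinearMap.range s) ∧
    IsLargestExtension T (fun α => π α < π i) (LinearMap.range s)
      (LinearMap.ker (X.d (-(π i : ℤ)) (-(π i : ℤ) + 1)).hom)
  step : ∀ j : ℕ, 0 < j → j < π i →
    IsInjectiveHull (LinearMap.range (X.d (-(j : ℤ) - 1) (-(j : ℤ))).hom) ∧
    IsLargestExtension T (fun α => π α < j)
      (LinearMap.range (X.d (-(j : ℤ) - 1) (-(j : ℤ))).hom)
      (LinearMap.ker (X.d (-(j : ℤ)) (-(j : ℤ) + 1)).hom)
  last : 0 < π i → Function.Surjective (X.d (-1) 0).hom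

/-- `T_1, …, T_e` (indexed here by `0, …, e - 1`) is the labelling of the simple modules of the
group algebra `k[G]` with `T_1` trivial and such that the first `e` radical layers of the projective
cover of `T_1` are `T_1, …, T_e`. -/
structure IsStandardLabelling {k : Type u} [Field k] {G : Type} [Group G] {e : ℕ} [NeZero e]
    (T : Fin e → ModuleCat.{u} (MonoidAlgebra k G)) : Prop where
  simple : ∀ i, IsSimpleModule (MonoidAlgebra k G) (T i)
  distinct : ∀ i j, Nonempty (T i ≃ₗ[MonoidAlgebra k G] T j) → i = j
  exhaustive : ∀ S : ModuleCat.{u} (MonoidAlgebra k G), IsSimpleModule (MonoidAlgebra k G) S →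
    ∃ i, Nonempty (S ≃ₗ[MonoidAlgebra k G] T i)
  trivial : ∀ (g : G) (x : T 0), MonoidAlgebra.of k G g • x = x
  layers : ∃ (Q : ModuleCat.{u} (MonoidAlgebra k G)) (f : Q →ₗ[MonoidAlgebra k G] T 0),
    IsProjectiveCover f ∧ ∀ r : Fin e,
      Nonempty (Subquot (radPow (A := MonoidAlgebra k G) Q ((r : ℕ) + 1))
        (radPow (A := MonoidAlgebra k G) Q (r : ℕ)) ≃ₗ[MonoidAlgebra k G] T r)

end Modules

/-! ### The groups `G = ℤ/N ⋊ E` -/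

/-- The ring `ℤ[exp(2πi/e)]`. -/
abbrev CycRing (e : ℕ) : Subalgebra ℤ ℂ :=
  Algebra.adjoin ℤ {Complex.exp (2 * Real.pi * Complex.I / e)}

/-- `E`, the cyclic subgroup of order `e` of `ℤ[exp(2πi/e)]ˣ`. -/
abbrev CycE (e : ℕ) : Subgroup (CycRing e)ˣ := rootsOfUnity e (CycRing e)

/-- `N` is admissible for `E`, through the ring homomorphism `φ : ℤ[exp(2πi/e)] → ℤ/N`: it is prime
to `e = |E|`, and `φ` is surjective and injective on `E`. -/
structure IsAdmissible (e : ℕ) {N : ℕ} (φ : CycRing e →+* ZMod N) : Prop where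
  coprime : Nat.Coprime e N
  surjective : Function.Surjective φ
  injOn : ∀ x y : CycE e, φ ((x : (CycRing e)ˣ) : CycRing e) = φ ((y : (CycRing e)ˣ) : CycRing e) →
    x = y

/-- The action of `E` on the (multiplicatively written) cyclic group `ℤ/N` induced by `φ`:
`ζ ∈ E` acts as multiplication by `φ ζ`. -/
def action {e N : ℕ} (φ : CycRing e →+* ZMod N) : CycE e →* MulAut (Multiplicative (ZMod N)) :=
  (((MulAutMultiplicative (ZMod N)).symm.toMonoidHom.comp AddAut.mulLeft).comp
    (Units.map φ.toMonoidHom)).comp (CycE e).subtype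

/-- `G_N = ℤ/N ⋊ E`. -/
abbrev Grp {e N : ℕ} (φ : CycRing e →+* ZMod N) : Type :=
  Multiplicative (ZMod N) ⋊[action φ] (CycE e)

section Simples

universe u

variable {e ℓ a : ℕ} [NeZero a] (φ : CycRing e →+* ZMod (ℓ ^ a)) (k : Type u) [Field k] [CharP k ℓ]

/-- The group algebra `k G`. -/
abbrev GrpAlg : Type u := MonoidAlgebra k (Grp φ)

/-- The reduction `ℤ[exp(2πi/e)] → ℤ/ℓ^a → k`. -/
def reduction : CycRing e →+* k :=
  (ZMod.castHom (dvd_pow_self ℓ (NeZero.ne a)) k).comp φ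

/-- The character `G → E → k`, the reduction of the ordinary character `ζ ↦ ζ ^ i` of `E`. -/
def redChar (i : ℕ) : Grp φ →* k :=
  (powMonoidHom i).comp (((reduction φ k).toMonoidHom.comp (Units.coeHom (CycRing e))).comp
    ((CycE e).subtype.comp SemidirectProduct.rightHom))

/-- The simple `k G`-module identified with the ordinary character `ζ ↦ ζ ^ i` of `E`: it is `k`
with `G` acting through `redChar φ k i`. -/
def simpleMod (i : Fin e) : ModuleCat.{u} (GrpAlg φ k) :=
  (ModuleCat.restrictScalars (MonoidAlgebra.lift k k (Grp φ) (redChar φ k i)).toRingHom).obj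
    (ModuleCat.of k k)

end Simples

/-! ### Genericity -/

section Generic

universe u v w w'

/-- For module families `T` over `A` and `T'` over `A'` with the same labels, `N` and `N'` are
identified uniserial modules: `N = U_{α,β}` and `N' = U'_{α,β}` for the same label `α` and the same
`β` with `b ≤ β ≤ e`. (For `b = 0` the zero modules are allowed and identified.) -/
def AreIdentified {A : Type u} [Ring A] {A' : Type v} [Ring A'] {e : ℕ}
    (T : Fin e → ModuleCat.{w} A) (T' : Fin e → ModuleCat.{w'} A') (b : ℕ)
    (N : ModuleCat.{w} A) (N' : ModuleCat.{w'} A') : Prop :=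
  ∃ (α : Fin e) (β : ℕ), b ≤ β ∧ β ≤ e ∧ IsU T α β N ∧ IsU T' α β N'

/-- The algorithm is generic for `(E, π)`, `E` cyclic of order `e`, with lower bound `m`:
for all admissible prime powers `ℓ^a`, `ℓ'^a'` at least `m`, and all complexes `X`, `X'` returned by
the algorithm for the same label `i`,
* the projective modules appearing in each (negative) degree are identified;
* the multisets of composition factors of the cohomologies are equal up to identification. -/
def IsGeneric (e : ℕ) (π : Fin e → ℕ) (m : ℕ) : Prop :=
  ∀ (ℓ ℓ' a a' : ℕ) [Fact ℓ.Prime] [Fact ℓ'.Prime] [NeZero a] [NeZero a']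
    (k : Type u) [Field k] [CharP k ℓ] (k' : Type v) [Field k'] [CharP k' ℓ']
    (φ : CycRing e →+* ZMod (ℓ ^ a)) (φ' : CycRing e →+* ZMod (ℓ' ^ a')),
    IsAdmissible e φ → IsAdmissible e φ' → m ≤ ℓ ^ a → m ≤ ℓ' ^ a' →
    ∀ (i : Fin e) (X : CochainComplex (ModuleCat.{u} (GrpAlg φ k)) ℤ)
      (X' : CochainComplex (ModuleCat.{v} (GrpAlg φ' k')) ℤ),
      IsAlgorithmOutput (simpleMod φ k) π i X → IsAlgorithmOutput (simpleMod φ' k') π i X' →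
      (∀ j : ℕ, 1 ≤ j → j ≤ π i → ∃ n : Fin e → ℕ,
        IsProjectiveOfType (simpleMod φ k) n (X.X (-(j : ℤ))) ∧
        IsProjectiveOfType (simpleMod φ' k') n (X'.X (-(j : ℤ)))) ∧
      (∀ j : ℕ, ∃ c : Multiset (Fin e),
        HasCompositionFactors (simpleMod φ k) c (X.homology (-(j : ℤ))) ∧
        HasCompositionFactors (simpleMod φ' k') c (X'.homology (-(j : ℤ))))

end Generic

end PerverseAlg

end

open PerverseAlg

universe u v

noncomputable section

namespace PerverseAlg

open CategoryTheory Polynomial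

universe w

/-! The group algebra of `ℤ/N ⋊ E`, `N = ℓ^a`, is a self-injective Nakayama algebra
(`SkewGroupData.nakayamaData`): besides the `e` idempotents of the characters of `E` it is generated
by one element `x` with `x ^ N = 0` that raises weights by one. A module generated by a weight
vector is uniserial, the labels of its layers increase by one in `ℤ/e` from top to socle, and it is
determined by its socle and its length. Every module met by the algorithm is of this kind. The
indecomposable projectives are the ones of length `N`, and they are also injective. The number `N`
matters only through `e < N` and `N ≡ 1 mod e`; the congruence says that top and socle of an
indecomposable projective agree.

A step with threshold `j` starts from `L ⊆ P` with socle `s` and length `b`. The labels above `L`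
are `s - b, s - b - 1, …`; if `γ` of them precede the first one of perversity at least `j`, then `M`
has length `b + γ` and `P / M` has length `N - b - γ`. The socle `s` itself has perversity at least
`j`, and labels are periodic modulo `e`, so `γ` is bounded. Hence the lengths alternate between `b`
and `N - b` with `1 ≤ b ≤ e`: a step replaces `b` by `b + γ` after an even number of steps and by `b
- γ` after an odd number. Above a module of length `N - b` the next label is `s - (N - b) = s - 1 +
b`. So the pair `(s, b)` obeys a recursion, `run`, in which `N` does not occur, and this is
genericity.

`run_spec` and `runGap_spec` give the bounds, `exists_isGen_of_isAlgorithmOutput` identifies any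
output with the recursion, `isUni_homology` reads off the cohomology, and `exists_isAlgorithmOutput`
builds an output from left ideals and right multiplications by powers of `x`. -/

/-- A homogeneous nilpotent generator `x` and a full set of idempotents `ε` presenting the
`k`-algebra `A` as the skew group algebra of `k[x]/(x^N)`, i.e. as a self-injective Nakayama algebra
with `e` simple modules and Loewy length `N`. -/
structure NakayamaData (k : Type*) [Field k] (A : Type*) [Ring A] [Algebra k A] (e N : ℕ)
    [NeZero e] where
  x : A
  ε : ZMod e → A
  mul_self : ∀ α, ε α * ε α = ε α
  mul_of_ne : ∀ α β, α ≠ β → ε α * ε β = 0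
  sum_eq_one : ∑ α, ε α = 1
  shift : ∀ α, ε (α + 1) * x = x * ε α
  pow_eq_zero : x ^ N = 0
  exists_poly : ∀ a α, ∃ p : k[X], a * ε α = aeval x p * ε α
  pow_mul_ne_zero : ∀ α, x ^ (N - 1) * ε α ≠ 0
  one_lt : 1 < N

/-! ### Uniserial modules generated by a weight vector -/

section Theory

variable {k : Type*} [Field k] {A : Type*} [Ring A] [Algebra k A] {e N : ℕ} [NeZero e]
variable (D : NakayamaData k A e N)
variable {V : Type*} [AddCommGroup V] [Module A V] {W : Type*} [AddCommGroup W] [Module A W]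

/-- Modulo a power of `X`, a polynomial is a unit times a power of `X`. -/
lemma exists_mul_sub_X_pow (p : k[X]) {r : ℕ} (h : ¬ X ^ r ∣ p) (n : ℕ) :
    ∃ s < r, X ^ s ∣ p ∧ ∃ q : k[X], X ^ n ∣ q * p - X ^ s := by
  have hp : p ≠ 0 := by rintro rfl; exact h (dvd_zero _)
  obtain ⟨u, hu, hu'⟩ := exists_eq_pow_rootMultiplicity_mul_and_not_dvd p hp 0
  set s := rootMultiplicity 0 p
  rw [map_zero, sub_zero] at hu hu'
  refine ⟨s, ?_, ⟨u, hu⟩, ?_⟩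
  · by_contra! hs
    exact h ((pow_dvd_pow X hs).trans ⟨u, hu⟩)
  · have hc : IsCoprime (X ^ n) u :=
      ((irreducible_X.coprime_iff_not_dvd).2 hu').pow_left
    obtain ⟨a, b, hab⟩ := hc
    refine ⟨b, -(a * X ^ s), ?_⟩
    calc b * p - X ^ s = X ^ s * (b * u - 1) := by rw [hu]; ring
      _ = X ^ s * (b * u - (a * X ^ n + b * u)) := by rw [hab]
      _ = _ := by ring

lemma span_singleton_mk_eq_top (v : V) :
    Submodule.span A {(⟨v, Submodule.mem_span_singleton_self v⟩ : Submodule.span A {v})} = ⊤ := by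
  apply Submodule.map_injective_of_injective (Submodule.injective_subtype _)
  rw [Submodule.map_span, Set.image_singleton, Submodule.map_top, Submodule.range_subtype]
  rfl

namespace NakayamaData

/-- `v` generates `V`, has weight `τ`, and its annihilator in `k[x]` is generated by `x ^ β`. -/
structure IsGen (τ : ZMod e) (β : ℕ) (v : V) : Prop where
  weight : D.ε τ • v = v
  span : Submodule.span A {v} = ⊤
  ann : ∀ p : k[X], aeval D.x p • v = 0 ↔ X ^ β ∣ p

lemma shift_nat (n : ℕ) (α : ZMod e) : D.ε (α + n) * D.x ^ n = D.x ^ n * D.ε α := by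
  induction n generalizing α with
  | zero => simp
  | succ n ih =>
    rw [pow_succ, ← mul_assoc, Nat.cast_succ, ← add_assoc, add_right_comm, ih, mul_assoc, D.shift,
      mul_assoc]

lemma pow_eq_zero_of_le {n : ℕ} (h : N ≤ n) : D.x ^ n = 0 :=
  _root_.pow_eq_zero_of_le h D.pow_eq_zero

lemma weight_pow {τ : ZMod e} {v : V} (hv : D.ε τ • v = v) (r : ℕ) :
    D.ε (τ + r) • (D.x ^ r • v) = D.x ^ r • v := by
  rw [← mul_smul, shift_nat, mul_smul, hv]

lemma aeval_smul_of_dvd {p : k[X]} {β : ℕ} {v : V} (hv : D.x ^ β • v = 0) (h : X ^ β ∣ p) :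
    aeval D.x p • v = 0 := by
  obtain ⟨q, rfl⟩ := h
  rw [mul_comm, map_mul, mul_smul, map_pow, aeval_X, hv, smul_zero]

/-- If `X ^ β ∤ p`, a multiple of `p` is congruent to `X ^ s` modulo `X ^ β` for some `s < β`, so
`p(x) v = 0` would kill `x ^ (β - 1) v`. One nonvanishing therefore controls the whole annihilator.
-/
lemma IsGen.mk' {τ : ZMod e} {β : ℕ} {v : V} (hw : D.ε τ • v = v)
    (hs : Submodule.span A {v} = ⊤) (hz : D.x ^ β • v = 0)
    (hn : β ≠ 0 → D.x ^ (β - 1) • v ≠ 0) : D.IsGen τ β v where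
  weight := hw
  span := hs
  ann p := by
    refine ⟨fun h => ?_, D.aeval_smul_of_dvd hz⟩
    by_contra hp
    obtain ⟨s, hs, -, q, hq⟩ := exists_mul_sub_X_pow p hp β
    have h1 := D.aeval_smul_of_dvd hz hq
    rw [map_sub, map_mul, sub_smul, mul_smul, h, smul_zero, zero_sub, neg_eq_zero, map_pow,
      aeval_X] at h1
    apply hn (by omega)
    rw [← Nat.sub_add_cancel (show s ≤ β - 1 by omega), pow_add, mul_smul, h1, smul_zero]

variable {D}

lemma exists_poly_smul {τ : ZMod e} {v : V} (hv : D.ε τ • v = v) (a : A) :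
    ∃ p : k[X], a • v = aeval D.x p • v := by
  obtain ⟨p, hp⟩ := D.exists_poly a τ
  refine ⟨p, ?_⟩
  rw [← hv, ← mul_smul, hp, mul_smul]

variable {τ τ' : ZMod e} {β β' : ℕ} {v : V} {w : W}

lemma IsGen.exists_eq (h : D.IsGen τ β v) (u : V) : ∃ p : k[X], u = aeval D.x p • v := by
  obtain ⟨a, rfl⟩ := Submodule.mem_span_singleton.1 (h.span ▸ Submodule.mem_top : u ∈ _)
  exact exists_poly_smul h.weight a

lemma IsGen.pow_smul (h : D.IsGen τ β v) : D.x ^ β • v = 0 := by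
  simpa using (h.ann (X ^ β)).2 dvd_rfl

lemma IsGen.pow_smul_eq_zero_iff (h : D.IsGen τ β v) (r : ℕ) : D.x ^ r • v = 0 ↔ β ≤ r := by
  have := h.ann (X ^ r)
  rw [map_pow, aeval_X] at this
  rw [this, pow_dvd_pow_iff X_ne_zero not_isUnit_X]

lemma IsGen.le (h : D.IsGen τ β v) : β ≤ N := by
  rw [← h.pow_smul_eq_zero_iff, D.pow_eq_zero, zero_smul]

lemma IsGen.smul_mem (h : D.IsGen τ β v) (K : Submodule A V) (p : k[X]) {r : ℕ}
    (hr : ¬ X ^ (r + 1) ∣ p) (hp : aeval D.x p • v ∈ K) : D.x ^ r • v ∈ K := by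
  obtain ⟨s, hs, -, q, hq⟩ := exists_mul_sub_X_pow p hr β
  have h1 := (h.ann _).2 hq
  rw [map_sub, map_mul, sub_smul, mul_smul, sub_eq_zero, map_pow, aeval_X] at h1
  rw [← Nat.sub_add_cancel (show s ≤ r by omega), pow_add, mul_smul, ← h1]
  exact K.smul_mem _ (K.smul_mem _ hp)

variable (D) in
/-- The submodule generated by `x ^ r • v`. -/
def layer (v : V) (r : ℕ) : Submodule A V := Submodule.span A {D.x ^ r • v}

lemma mem_layer_self (v : V) (r : ℕ) : D.x ^ r • v ∈ D.layer v r :=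
  Submodule.mem_span_singleton_self _

lemma layer_anti (v : V) : Antitone (D.layer v) := by
  intro r s h
  rw [layer, Submodule.span_singleton_le_iff_mem, ← Nat.sub_add_cancel h, pow_add, mul_smul]
  exact Submodule.smul_mem _ _ (mem_layer_self v r)

lemma IsGen.layer_zero (h : D.IsGen τ β v) : D.layer v 0 = ⊤ := by
  rw [layer, pow_zero, one_smul, h.span]

lemma IsGen.layer_eq_bot (h : D.IsGen τ β v) {r : ℕ} (hr : β ≤ r) : D.layer v r = ⊥ := by
  rw [layer, (h.pow_smul_eq_zero_iff r).2 hr, Submodule.span_zero_singleton]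

lemma IsGen.mem_layer (h : D.IsGen τ β v) {r : ℕ} (hr : r ≤ β) (p : k[X]) :
    aeval D.x p • v ∈ D.layer v r ↔ X ^ r ∣ p := by
  constructor
  · intro hp
    obtain ⟨a, ha⟩ := Submodule.mem_span_singleton.1 hp
    obtain ⟨q, hq⟩ := exists_poly_smul (D.weight_pow h.weight r) a
    rw [hq] at ha
    have h1 : X ^ β ∣ q * X ^ r - p := by
      rw [← h.ann, map_sub, map_mul, map_pow, aeval_X, sub_smul, mul_smul, ha, sub_self]
    have h2 := (dvd_sub_right (dvd_mul_left (X ^ r) q)).1 ((pow_dvd_pow X hr).trans h1)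
    exact h2
  · rintro ⟨q, rfl⟩
    rw [mul_comm, map_mul, mul_smul, map_pow, aeval_X]
    exact Submodule.smul_mem _ _ (mem_layer_self v r)

lemma IsGen.pow_mem_layer (h : D.IsGen τ β v) {r s : ℕ} (hr : r ≤ β) :
    D.x ^ s • v ∈ D.layer v r ↔ r ≤ s := by
  have := h.mem_layer hr (X ^ s)
  rw [map_pow, aeval_X] at this
  rw [this, pow_dvd_pow_iff X_ne_zero not_isUnit_X]

lemma IsGen.layer_le_iff (h : D.IsGen τ β v) {r s : ℕ} (hr : r ≤ β) :
    D.layer v s ≤ D.layer v r ↔ r ≤ s := by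
  rw [layer, Submodule.span_singleton_le_iff_mem, h.pow_mem_layer hr]

lemma IsGen.layer_inj (h : D.IsGen τ β v) {r s : ℕ} (hr : r ≤ β) (hs : s ≤ β)
    (he : D.layer v r = D.layer v s) : r = s :=
  le_antisymm ((h.layer_le_iff hr).1 he.ge) ((h.layer_le_iff hs).1 he.le)

/-- Take the least `r` with `x ^ r v ∈ K`. An element `p(x) v` of `K` with `X ^ r ∤ p` would, after
multiplication by a suitable polynomial, put a smaller power into `K`. -/
lemma IsGen.exists_eq_layer (h : D.IsGen τ β v) (K : Submodule A V) :
    ∃ r ≤ β, K = D.layer v r := by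
  classical
  have hex : ∃ r, D.x ^ r • v ∈ K := ⟨β, by rw [h.pow_smul]; exact K.zero_mem⟩
  have hle : Nat.find hex ≤ β := Nat.find_min' hex (by rw [h.pow_smul]; exact K.zero_mem)
  refine ⟨Nat.find hex, hle, le_antisymm (fun u hu => ?_) ?_⟩
  · obtain ⟨p, rfl⟩ := h.exists_eq u
    rw [h.mem_layer hle]
    by_contra hp
    have h0 : Nat.find hex ≠ 0 := by
      intro h0
      simp [h0] at hp
    obtain ⟨r, hr⟩ := Nat.exists_eq_succ_of_ne_zero h0
    rw [hr] at hp
    exact Nat.find_min hex (by omega) (h.smul_mem K p hp hu)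
  · rw [layer, Submodule.span_singleton_le_iff_mem]
    exact Nat.find_spec hex

lemma IsGen.isUniserial (h : D.IsGen τ β v) : IsUniserial A V := by
  intro K K'
  obtain ⟨r, -, rfl⟩ := h.exists_eq_layer K
  obtain ⟨s, -, rfl⟩ := h.exists_eq_layer K'
  rcases le_total r s with hrs | hrs
  · exact Or.inr (layer_anti v hrs)
  · exact Or.inl (layer_anti v hrs)

lemma IsGen.map_equiv (h : D.IsGen τ β v) (f : V ≃ₗ[A] W) : D.IsGen τ β (f v) where
  weight := by rw [← map_smul, h.weight]
  span := by
    have := congrArg (Submodule.map f.toLinearMap) h.span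
    rw [Submodule.map_span, Set.image_singleton, Submodule.map_top, LinearEquiv.range] at this
    exact this
  ann p := by rw [← map_smul, f.map_eq_zero_iff, h.ann]

lemma IsGen.quotient (h : D.IsGen τ β v) {r : ℕ} (hr : r ≤ β) :
    D.IsGen τ r (Submodule.Quotient.mk v : V ⧸ D.layer v r) where
  weight := by rw [← Submodule.Quotient.mk_smul, h.weight]
  span := by
    have := congrArg (Submodule.map (D.layer v r).mkQ) h.span
    rwa [Submodule.map_span, Set.image_singleton, Submodule.map_top, Submodule.range_mkQ] at this
  ann p := by rw [← Submodule.Quotient.mk_smul, Submodule.Quotient.mk_eq_zero, h.mem_layer hr]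

lemma IsGen.sub (h : D.IsGen τ β v) {r : ℕ} (hr : r ≤ β) :
    D.IsGen (τ + r) (β - r) (⟨D.x ^ r • v, mem_layer_self v r⟩ : D.layer v r) where
  weight := Subtype.ext (D.weight_pow h.weight r)
  span := span_singleton_mk_eq_top _
  ann p := by
    rw [← Submodule.coe_eq_zero, Submodule.coe_smul]
    dsimp only
    rw [← mul_smul]
    have h1 : aeval D.x p * D.x ^ r = aeval D.x (p * X ^ r) := by simp
    rw [h1, h.ann, ← Nat.sub_add_cancel hr, pow_add, Nat.add_sub_cancel]
    exact mul_dvd_mul_iff_right (pow_ne_zero r X_ne_zero)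

lemma IsGen.layer_submoduleOf {r s : ℕ} (hrs : r ≤ s) :
    (D.layer v s).submoduleOf (D.layer v r) =
      D.layer (⟨D.x ^ r • v, mem_layer_self v r⟩ : D.layer v r) (s - r) := by
  apply Submodule.map_injective_of_injective (D.layer v r).injective_subtype
  rw [Submodule.submoduleOf, Submodule.map_comap_subtype, inf_eq_right.2 (layer_anti v hrs)]
  unfold layer
  rw [Submodule.map_span, Set.image_singleton, Submodule.subtype_apply, Submodule.coe_smul,
    ← mul_smul, ← pow_add, Nat.sub_add_cancel hrs]

lemma IsGen.subquot (h : D.IsGen τ β v) {r s : ℕ} (hrs : r ≤ s) (hs : s ≤ β) :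
    D.IsGen (τ + r) (s - r) (Submodule.Quotient.mk ⟨D.x ^ r • v, mem_layer_self v r⟩ :
      Subquot (D.layer v s) (D.layer v r)) := by
  have := (h.sub (hrs.trans hs)).quotient (show s - r ≤ β - r by omega)
  rw [← IsGen.layer_submoduleOf hrs] at this
  exact this

/-- Since `A ε τ = k[x] ε τ`, the annihilator of `v` in `A` is governed by that in `k[x]`; a vector
of weight `τ` killed by `x ^ β` satisfies all relations of `v`. -/
lemma IsGen.exists_hom (h : D.IsGen τ β v) (hw : D.ε τ • w = w) (hz : D.x ^ β • w = 0) :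
    ∃ f : V →ₗ[A] W, f v = w := by
  let g : A →ₗ[A] V := LinearMap.toSpanSingleton A V v
  let g' : A →ₗ[A] W := LinearMap.toSpanSingleton A W w
  have hg : Function.Surjective g := by
    rw [← LinearMap.range_eq_top, LinearMap.range_toSpanSingleton, h.span]
  have hk : LinearMap.ker g ≤ LinearMap.ker g' := by
    intro a ha
    rw [LinearMap.mem_ker, LinearMap.toSpanSingleton_apply] at ha ⊢
    obtain ⟨p, hp⟩ := D.exists_poly a τ
    have hv : aeval D.x p • v = 0 := by rw [← h.weight, ← mul_smul, ← hp, mul_smul, h.weight, ha]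
    rw [← hw, ← mul_smul, hp, mul_smul, hw]
    exact D.aeval_smul_of_dvd hz ((h.ann p).1 hv)
  refine ⟨(LinearMap.ker g).liftQ g' hk ∘ₗ (g.quotKerEquivOfSurjective hg).symm, ?_⟩
  have : (g.quotKerEquivOfSurjective hg).symm v = (LinearMap.ker g).mkQ 1 := by
    rw [LinearEquiv.symm_apply_eq, Submodule.mkQ_apply, LinearMap.quotKerEquivOfSurjective_apply_mk,
      LinearMap.toSpanSingleton_apply, one_smul]
  rw [LinearMap.comp_apply, LinearEquiv.coe_coe, this, Submodule.mkQ_apply,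
    Submodule.liftQ_apply, LinearMap.toSpanSingleton_apply, one_smul]

lemma IsGen.hom_ext (h : D.IsGen τ β v) {f g : V →ₗ[A] W} (hfg : f v = g v) : f = g :=
  LinearMap.ext_on h.span (by simpa using hfg)

lemma IsGen.exists_equiv (h : D.IsGen τ β v) (h' : D.IsGen τ β w) :
    ∃ f : V ≃ₗ[A] W, f v = w := by
  obtain ⟨f, hf⟩ := h.exists_hom h'.weight h'.pow_smul
  obtain ⟨g, hg⟩ := h'.exists_hom h.weight h.pow_smul
  exact ⟨LinearEquiv.ofLinearMap f g (h'.hom_ext (by simp [hf, hg])) (h.hom_ext (by simp [hf, hg])), hf⟩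

lemma IsGen.ne_zero (h : D.IsGen τ β v) (hβ : β ≠ 0) : v ≠ 0 := by
  intro hv
  have := (h.pow_smul_eq_zero_iff 0).1 (by rw [hv, smul_zero])
  omega

lemma IsGen.subsingleton (h : D.IsGen τ 0 v) : Subsingleton V := by
  have := h.layer_eq_bot le_rfl
  rw [h.layer_zero] at this
  exact (Submodule.subsingleton_iff A).1 (subsingleton_of_bot_eq_top this.symm)

lemma IsGen.isSimpleModule (h : D.IsGen τ 1 v) : IsSimpleModule A V := by
  have : Nontrivial V := ⟨v, 0, h.ne_zero one_ne_zero⟩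
  rw [isSimpleModule_iff]
  refine { eq_bot_or_eq_top := fun K => ?_ }
  obtain ⟨r, hr, rfl⟩ := h.exists_eq_layer K
  obtain rfl | rfl : r = 0 ∨ r = 1 := by omega
  · exact Or.inr h.layer_zero
  · exact Or.inl (h.layer_eq_bot le_rfl)

lemma IsGen.length_eq (h : D.IsGen τ β v) : Module.length A V = β := by
  induction β generalizing V τ with
  | zero =>
    have := h.subsingleton
    simp
  | succ β ih =>
    have h1 := h.quotient (r := 1) (by omega)
    have h2 := ih (h.sub (r := 1) (by omega))
    have h3 := h1.isSimpleModule
    rw [Module.length_eq_add_of_exact (D.layer v 1).subtype (D.layer v 1).mkQ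
      (Submodule.injective_subtype _) (Submodule.mkQ_surjective _) (LinearMap.exact_subtype_mkQ _),
      h2, Module.length_eq_one]
    push_cast
    rfl

/-- The length determines `β`. Modulo `x V`, the generator `v'` is a nonzero scalar multiple of `v`,
so it is fixed by both `ε τ` and `ε τ'`, which are orthogonal if `τ ≠ τ'`. -/
lemma IsGen.unique (h : D.IsGen τ β v) {v' : V} (h' : D.IsGen τ' β' v') (hβ : β ≠ 0) :
    τ = τ' ∧ β = β' := by
  have hb : β = β' := by
    have := h.length_eq.symm.trans h'.length_eq
    exact_mod_cast this
  subst hb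
  refine ⟨?_, rfl⟩
  by_contra hne
  obtain ⟨p, hp⟩ := h.exists_eq v'
  have hp1 : ¬ X ∣ p := by
    rintro ⟨q, rfl⟩
    have h1 : v' ∈ D.layer v 1 := by
      rw [hp, h.mem_layer (by omega), pow_one]
      exact dvd_mul_right _ _
    have h2 : D.layer v 1 = ⊤ := by
      rw [eq_top_iff, ← h'.span, Submodule.span_singleton_le_iff_mem]
      exact h1
    have := h.layer_inj (by omega) (by omega) (h2.trans h.layer_zero.symm)
    omega
  -- the leading coefficient of `v'` has weight `τ`
  have h1 : D.IsGen τ 1 _ := h.quotient (r := 1) (by omega)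
  set u : V ⧸ D.layer v 1 := Submodule.Quotient.mk v
  have h2 : (Submodule.Quotient.mk v' : V ⧸ D.layer v 1) = aeval D.x (C (p.coeff 0)) • u := by
    rw [hp, Submodule.Quotient.mk_smul, ← sub_eq_zero, ← sub_smul, ← map_sub, h1.ann, pow_one,
      X_dvd_iff]
    simp
  have h3 : D.ε τ' • (Submodule.Quotient.mk v' : V ⧸ D.layer v 1) = Submodule.Quotient.mk v' := by
    rw [← Submodule.Quotient.mk_smul, h'.weight]
  have h4 : D.ε τ • (Submodule.Quotient.mk v' : V ⧸ D.layer v 1) = Submodule.Quotient.mk v' := by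
    rw [h2, ← mul_smul, aeval_C, ← Algebra.commutes, mul_smul, h1.weight]
  rw [← h3, ← mul_smul, D.mul_of_ne _ _ hne, zero_smul, eq_comm, h3,
    Submodule.Quotient.mk_eq_zero, hp, h.mem_layer (by omega), pow_one] at h4
  exact hp1 h4

/-- The map `a ↦ a v` from `A` onto `V` is split by `v ↦ ε τ`, as `x ^ N = 0` is the only relation
to check. -/
lemma IsGen.projective (h : D.IsGen τ N v) : Module.Projective A V := by
  obtain ⟨f, hf⟩ := h.exists_hom (w := D.ε τ) (by rw [smul_eq_mul, D.mul_self])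
    (by rw [D.pow_eq_zero, zero_smul])
  refine Module.Projective.of_split f (LinearMap.toSpanSingleton A V v) (h.hom_ext ?_)
  rw [LinearMap.comp_apply, hf, LinearMap.toSpanSingleton_apply, h.weight, LinearMap.id_apply]

/-- The projective indecomposable module `A ε τ`. -/
lemma isGen_ideal (τ : ZMod e) :
    D.IsGen τ N (⟨D.ε τ, Submodule.mem_span_singleton_self _⟩ : Submodule.span A {D.ε τ}) := by
  have := D.one_lt
  apply IsGen.mk'
  · exact Subtype.ext (D.mul_self τ)
  · exact span_singleton_mk_eq_top _
  · rw [D.pow_eq_zero, zero_smul]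
  · intro _ h0
    exact D.pow_mul_ne_zero τ (congrArg Subtype.val h0)

end NakayamaData

end Theory

/-! ### Injectivity, injective hulls, socles, radical layers and composition factors -/

namespace NakayamaData

variable {k : Type*} [Field k] {A : Type*} [Ring A] [Algebra k A] {e N : ℕ} [NeZero e]
variable {D : NakayamaData k A e N}
variable {V : Type*} [AddCommGroup V] [Module A V] {W : Type*} [AddCommGroup W] [Module A W]
variable {τ τ' : ZMod e} {β β' : ℕ} {v : V} {w : W}

variable (D) in
lemma adjoin_eq_top : Algebra.adjoin k (insert D.x (Set.range D.ε)) = ⊤ := by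
  rw [eq_top_iff]
  rintro a -
  rw [← mul_one a, ← D.sum_eq_one, Finset.mul_sum]
  refine sum_mem fun α _ => ?_
  obtain ⟨p, hp⟩ := D.exists_poly a α
  rw [hp]
  refine mul_mem ?_ (Algebra.subset_adjoin (Set.mem_insert_of_mem _ ⟨α, rfl⟩))
  exact Algebra.adjoin_mono (by simp) (aeval_mem_adjoin_singleton k D.x)

lemma ε_mul_pow (α β : ZMod e) (n : ℕ) :
    D.ε α * (D.x ^ n * D.ε β) = if α = β + n then D.x ^ n * D.ε β else 0 := by
  rw [← shift_nat, ← mul_assoc]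
  split_ifs with h
  · rw [h, D.mul_self]
  · rw [D.mul_of_ne _ _ h, zero_mul]

lemma IsGen.ε_smul_pow (h : D.IsGen τ β v) (α : ZMod e) (n : ℕ) :
    D.ε α • D.x ^ n • v = if α = τ + n then D.x ^ n • v else 0 := by
  have := congrArg (· • v) (ε_mul_pow (D := D) α τ n)
  simp only [ite_smul, zero_smul, mul_smul, h.weight] at this
  exact this

/-- An element `u` of `V` is recovered from the values `c (x ^ m u)`, where `c` is the functional
reading off the socle coefficient. Extending an `A`-linear map into `V` thus reduces to extending a
linear functional over the field `k`. -/
lemma IsGen.injective {V : Type v} [AddCommGroup V] [Module A V] {v : V} (h : D.IsGen τ N v) :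
    Module.Injective A V := by
  refine ⟨fun M M' _ _ _ _ f hf g => ?_⟩
  let _ : Module k V := Module.compHom V (algebraMap k A)
  let _ : Module k M := Module.compHom M (algebraMap k A)
  let _ : Module k M' := Module.compHom M' (algebraMap k A)
  have : IsScalarTower k A V := IsScalarTower.of_algebraMap_smul fun _ _ => rfl
  have : IsScalarTower k A M := IsScalarTower.of_algebraMap_smul fun _ _ => rfl
  have : IsScalarTower k A M' := IsScalarTower.of_algebraMap_smul fun _ _ => rfl
  obtain ⟨n, rfl⟩ : ∃ n, N = n + 1 := ⟨N - 1, by have := D.one_lt; omega⟩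
  -- the coefficient of the socle element
  obtain ⟨c, hc⟩ : ∃ c : V →ₗ[k] k, ∀ p : k[X], c (aeval D.x p • v) = p.coeff n := by
    let G : k[X] →ₗ[k] V :=
      ((LinearMap.toSpanSingleton A V v).restrictScalars k) ∘ₗ (aeval D.x).toLinearMap
    have hG : ∀ p, G p = aeval D.x p • v := fun p => rfl
    have hs : Function.Surjective G := fun u => by
      obtain ⟨p, hp⟩ := h.exists_eq u
      exact ⟨p, hp.symm⟩
    have hk : LinearMap.ker G ≤ LinearMap.ker (lcoeff k n) := by
      intro p hp
      rw [LinearMap.mem_ker, hG, h.ann, X_pow_dvd_iff] at hp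
      exact hp n n.lt_succ_self
    refine ⟨(LinearMap.ker G).liftQ _ hk ∘ₗ (G.quotKerEquivOfSurjective hs).symm, fun p => ?_⟩
    have : (G.quotKerEquivOfSurjective hs).symm (G p) = (LinearMap.ker G).mkQ p := by
      rw [LinearEquiv.symm_apply_eq]
      rfl
    rw [← hG, LinearMap.comp_apply, LinearEquiv.coe_coe, this]
    rfl
  have hcx : ∀ m : ℕ, c (D.x ^ m • v) = if m = n then 1 else 0 := by
    intro m
    have := hc (X ^ m)
    rw [map_pow, aeval_X, coeff_X_pow] at this
    simp only [this, eq_comm]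
  -- The socle has weight `τ + n`, so `c` ignores all other weights.
  have hcε : ∀ u, c (D.ε (τ + n) • u) = c u := by
    intro u
    obtain ⟨p, rfl⟩ := h.exists_eq u
    induction p using Polynomial.induction_on' with
    | add p q hp hq => rw [map_add, add_smul, smul_add, map_add, map_add, hp, hq]
    | monomial m a =>
      rw [aeval_monomial, mul_smul, algebraMap_smul, smul_comm (D.ε _) a, c.map_smul, c.map_smul, h.ε_smul_pow]
      split_ifs with h1
      · rfl
      · rw [hcx, if_neg (by rintro rfl; exact h1 rfl), map_zero]
  have hform : ∀ u, ∑ r ∈ Finset.range (n + 1), c (D.x ^ (n - r) • u) • (D.x ^ r • v) = u := by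
    intro u
    obtain ⟨p, rfl⟩ := h.exists_eq u
    induction p using Polynomial.induction_on' with
    | add p q hp hq =>
      rw [map_add, add_smul]
      conv_rhs => rw [← hp, ← hq]
      simp only [smul_add, map_add, add_smul, Finset.sum_add_distrib]
    | monomial m a =>
      rw [aeval_monomial, mul_smul, algebraMap_smul]
      simp only [smul_comm _ a, map_smul, ← mul_smul, ← pow_add, hcx]
      by_cases hm : m ≤ n
      · rw [Finset.sum_eq_single m]
        · rw [if_pos (by omega), smul_eq_mul, mul_one]
        · intro r hr hrm
          rw [Finset.mem_range] at hr
          rw [if_neg (by omega), smul_zero, zero_smul]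
        · intro hm'
          exact absurd (Finset.mem_range.2 (by omega)) hm'
      · rw [(h.pow_smul_eq_zero_iff m).2 (by omega), smul_zero]
        refine Finset.sum_eq_zero fun r hr => ?_
        rw [Finset.mem_range] at hr
        by_cases hr' : n - r + m = n
        · rw [if_pos hr', show r = m by omega, (h.pow_smul_eq_zero_iff m).2 (by omega), smul_zero]
        · rw [if_neg hr', smul_zero, zero_smul]
  obtain ⟨r, hr⟩ := (f.restrictScalars k).exists_leftInverse_of_injective
    (LinearMap.ker_eq_bot.2 hf)
  have hr' : ∀ x, r (f x) = x := fun x => LinearMap.congr_fun hr x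
  -- The factor `ε (τ + n)` makes `μ` live on the socle weight, which is what makes `H` commute with
  -- the idempotents; by `hcε` it changes nothing on the image of `f`.
  let μ : M' → k := fun y => c (g (r (D.ε (τ + n) • y)))
  have hμ_add : ∀ y z, μ (y + z) = μ y + μ z := fun y z => by simp only [μ, smul_add, map_add]
  have hμ_zero : μ 0 = 0 := by simp only [μ, smul_zero, map_zero]
  have hμ_smul : ∀ (a : k) y, μ (a • y) = a • μ y := fun a y => by
    have : ∀ z : M, g (a • z) = a • g z := fun z => (g.restrictScalars k).map_smul a z
    simp only [μ, smul_comm _ a, map_smul, this]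
  have hμ_ε : ∀ (m : ℕ) α y, μ (D.x ^ m • D.ε α • y) = if τ + n = α + m then μ (D.x ^ m • y) else 0 := by
    intro m α y
    have := ε_mul_pow (D := D) (τ + n) α m
    simp only [μ]
    rw [← mul_smul, ← mul_smul, mul_assoc, this]
    split_ifs with h1
    · rw [← shift_nat, ← h1, mul_smul]
    · simp
  let H : M' → V := fun y => ∑ r ∈ Finset.range (n + 1), μ (D.x ^ (n - r) • y) • (D.x ^ r • v)
  have hH_add : ∀ y z, H (y + z) = H y + H z := fun y z => by
    simp only [H, smul_add, hμ_add, add_smul, Finset.sum_add_distrib]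
  have hH_smul : ∀ (a : A) y, H (a • y) = a • H y := by
    intro a
    have ha : a ∈ Algebra.adjoin k (insert D.x (Set.range D.ε)) := by
      rw [D.adjoin_eq_top]
      trivial
    induction ha using Algebra.adjoin_induction with
    | mem a ha =>
      rcases ha with rfl | ⟨α, rfl⟩
      · intro y
        simp only [H, Finset.smul_sum, smul_comm D.x, ← mul_smul D.x, ← pow_succ']
        -- Shifting the index leaves two boundary terms: `r = n` on the right, killed by `x ^ N v =
        -- 0`, and `r = 0` on the left, killed by `x ^ N = 0`.
        rw [Finset.sum_range_succ', Finset.sum_range_succ, h.pow_smul, smul_zero, add_zero,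
          ← mul_smul, Nat.sub_zero, ← pow_succ, D.pow_eq_zero, zero_smul, hμ_zero, zero_smul,
          add_zero]
        refine Finset.sum_congr rfl fun i hi => ?_
        rw [Finset.mem_range] at hi
        rw [← mul_smul, ← pow_succ, show n - (i + 1) + 1 = n - i by omega]
      · intro y
        simp only [H, Finset.smul_sum, smul_comm (D.ε α), h.ε_smul_pow, hμ_ε]
        refine Finset.sum_congr rfl fun i hi => ?_
        rw [Finset.mem_range] at hi
        have : τ + n = α + ((n - i : ℕ) : ZMod e) ↔ α = τ + i := by
          rw [Nat.cast_sub (by omega)]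
          constructor
          · intro h1
            linear_combination -h1
          · intro h1
            linear_combination -h1
        simp only [this]
        split_ifs
        · rfl
        · rw [zero_smul, smul_zero]
    | algebraMap a =>
      intro y
      rw [algebraMap_smul, algebraMap_smul]
      simp only [H, Finset.smul_sum, smul_comm _ a y, hμ_smul, smul_assoc]
    | add a b _ _ ha hb =>
      intro y
      rw [add_smul, add_smul, hH_add, ha, hb]
    | mul a b _ _ ha hb =>
      intro y
      rw [mul_smul, mul_smul, ha, hb]
  refine ⟨{ toFun := H, map_add' := hH_add, map_smul' := hH_smul }, fun x => ?_⟩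
  change H (f x) = g x
  refine Eq.trans ?_ (hform (g x))
  refine Finset.sum_congr rfl fun i _ => ?_
  simp only [μ]
  rw [← f.map_smul, ← f.map_smul, hr', g.map_smul, g.map_smul, hcε]

lemma IsGen.map_layer (f : V →ₗ[A] W) (v : V) (r : ℕ) :
    (D.layer v r).map f = D.layer (f v) r := by
  rw [layer, Submodule.map_span, Set.image_singleton, map_smul, layer]

variable (D) in
/-- `V` is uniserial with `β` layers and, if `β ≠ 0`, socle of weight `s`. -/
def IsUni (s : ZMod e) (β : ℕ) (V : Type*) [AddCommGroup V] [Module A V] : Prop :=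
  ∃ v : V, D.IsGen (s - β + 1) β v

variable {s s' : ZMod e}

lemma IsGen.isUni (h : D.IsGen τ β v) (hs : τ = s - β + 1) : D.IsUni s β V := ⟨v, hs ▸ h⟩

lemma IsUni.congr (h : D.IsUni s β V) (f : V ≃ₗ[A] W) : D.IsUni s β W := by
  obtain ⟨v, hv⟩ := h
  exact ⟨f v, hv.map_equiv f⟩

lemma IsUni.nonempty_equiv (h : D.IsUni s β V) (h' : D.IsUni s β W) : Nonempty (V ≃ₗ[A] W) := by
  obtain ⟨v, hv⟩ := h
  obtain ⟨w, hw⟩ := h'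
  obtain ⟨f, -⟩ := hv.exists_equiv hw
  exact ⟨f⟩

lemma isUni_one_iff : D.IsUni s 1 V ↔ ∃ v : V, D.IsGen s 1 v := by
  rw [IsUni, Nat.cast_one, sub_add_cancel]

lemma isUni_zero [Subsingleton V] : D.IsUni s 0 V :=
  ⟨0, IsGen.mk' _ (by simp) (Subsingleton.elim _ _) (by simp) (by simp)⟩

/-- Every module in which `V` is embedded essentially, if injective, is the injective hull. -/
lemma IsUni.exists_isGen_of_isInjectiveHull {A : Type u} [Ring A] [Algebra k A]
    {D : NakayamaData k A e N} (hN : (N : ZMod e) = 1) {Q : Type u} [AddCommGroup Q] [Module A Q]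
    {L : Submodule A Q} (hL : IsInjectiveHull L) (h : D.IsUni s β L) (hβ : β ≠ 0) :
    ∃ v : Q, D.IsGen s N v ∧ L = D.layer v (N - β) := by
  obtain ⟨l, hl⟩ := h
  have hle := hl.le
  have hp := isGen_ideal (D := D) s
  set p : Submodule.span A {D.ε s} := ⟨D.ε s, Submodule.mem_span_singleton_self _⟩
  have h1 := hp.sub (r := N - β) (by omega)
  -- The submodule of length `β` in `A ε s` has top weight `s + N - β = s - β + 1`, the top weight
  -- of `L`.
  rw [Nat.sub_sub_self hle, Nat.cast_sub hle, hN, show s + (1 - (β : ZMod e)) = s - β + 1 by ring]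
    at h1
  obtain ⟨φ, -⟩ := h1.exists_equiv hl
  have := hL.injective
  obtain ⟨F, hF⟩ := hL.injective.out (D.layer p (N - β)).subtype (Submodule.injective_subtype _)
    (L.subtype ∘ₗ φ.toLinearMap)
  -- A nonzero kernel would contain the socle, which lies in the submodule on which `F` is the
  -- embedding of `L`.
  have hFinj : Function.Injective F := by
    rw [← LinearMap.ker_eq_bot]
    obtain ⟨r, hr, hk⟩ := hp.exists_eq_layer (LinearMap.ker F)
    by_cases hrN : r = N
    · rw [hk, hrN, hp.layer_eq_bot le_rfl]
    have h2 : D.x ^ (N - 1) • p ∈ LinearMap.ker F := by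
      rw [hk, hp.pow_mem_layer hr]
      omega
    have h3 : D.x ^ (N - 1) • p ∈ D.layer p (N - β) := by
      rw [hp.pow_mem_layer (by omega)]
      omega
    have h4 := hF ⟨_, h3⟩
    rw [Submodule.subtype_apply, LinearMap.mem_ker.1 h2, eq_comm, LinearMap.comp_apply,
      Submodule.subtype_apply, Submodule.coe_eq_zero, LinearEquiv.coe_coe,
      LinearEquiv.map_eq_zero_iff, ← Submodule.coe_eq_zero] at h4
    have := (hp.pow_smul_eq_zero_iff (N - 1)).1 h4
    have := D.one_lt
    omega
  have hLF : (D.layer p (N - β)).map F = L := by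
    have : F ∘ₗ (D.layer p (N - β)).subtype = L.subtype ∘ₗ φ.toLinearMap := LinearMap.ext hF
    rw [← Submodule.range_subtype (D.layer p (N - β)), ← LinearMap.range_comp, this,
      LinearMap.range_comp, LinearEquiv.range, Submodule.map_top, Submodule.range_subtype]
  -- Injectivity of the source gives a retraction `G` of `F`. Its kernel meets `L` trivially, hence
  -- vanishes by essentiality, and `F` is onto.
  obtain ⟨G, hG⟩ := hp.injective.out F hFinj LinearMap.id
  have hK : LinearMap.ker G = ⊥ := by
    apply hL.essential
    rw [eq_bot_iff]
    rintro q ⟨hq, hqL⟩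
    rw [SetLike.mem_coe, ← hLF] at hqL
    obtain ⟨z, -, rfl⟩ := hqL
    rw [SetLike.mem_coe, LinearMap.mem_ker, hG, LinearMap.id_apply] at hq
    rw [hq, map_zero]
    exact Submodule.zero_mem _
  have hFsurj : Function.Surjective F := fun q =>
    ⟨G q, LinearMap.ker_eq_bot.1 hK (by rw [hG, LinearMap.id_apply])⟩
  have hFbij : Function.Bijective F := ⟨hFinj, hFsurj⟩
  refine ⟨_, hp.map_equiv (LinearEquiv.ofBijective F hFbij), ?_⟩
  rw [LinearEquiv.ofBijective_apply, ← IsGen.map_layer, hLF]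

lemma IsGen.isInjectiveHull {V : Type v} [AddCommGroup V] [Module A V] {v : V}
    (h : D.IsGen τ N v) {r : ℕ} (hr : r < N) : IsInjectiveHull (D.layer v r) where
  injective := h.injective
  essential K hK := by
    rcases h.isUniserial K (D.layer v r) with h1 | h1
    · rwa [inf_eq_left.2 h1] at hK
    · rw [inf_eq_right.2 h1] at hK
      have := (h.layer_inj hr.le le_rfl (hK.trans (h.layer_eq_bot le_rfl).symm))
      omega

lemma IsGen.jacobson_eq (h : D.IsGen τ β v) (hβ : β ≠ 0) : Module.jacobson A V = D.layer v 1 := by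
  have h1 : D.layer v 1 ≠ ⊤ := by
    intro h1
    have := h.layer_inj (by omega) (by omega) (h1.trans h.layer_zero.symm)
    omega
  have h2 : ∀ K : Submodule A V, K ≠ ⊤ → K ≤ D.layer v 1 := by
    intro K hK
    obtain ⟨r, hr, rfl⟩ := h.exists_eq_layer K
    apply layer_anti
    by_contra hr0
    apply hK
    rw [show r = 0 by omega, h.layer_zero]
  have : {K : Submodule A V | IsCoatom K} = {D.layer v 1} := by
    ext K
    rw [Set.mem_ofPred_eq, Set.mem_singleton_iff]
    constructor
    · intro hK
      by_contra hne
      exact h1 (hK.2 _ (lt_of_le_of_ne (h2 K hK.1) hne))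
    · rintro rfl
      refine ⟨h1, fun K hK => ?_⟩
      by_contra hK'
      exact (h2 K hK').not_gt hK
  rw [Module.jacobson, this, sInf_singleton]

lemma IsGen.radPow_eq (h : D.IsGen τ β v) {r : ℕ} (hr : r ≤ β) :
    radPow (A := A) V r = D.layer v r := by
  induction r with
  | zero => rw [h.layer_zero]; rfl
  | succ r ih =>
    have key : ∀ K : Submodule A V, K = D.layer v r →
        (Module.jacobson A K).map K.subtype = D.layer v (r + 1) := by
      rintro K rfl
      rw [(h.sub (r := r) (by omega)).jacobson_eq (by omega), IsGen.map_layer,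
        Submodule.subtype_apply]
      unfold layer
      rw [← mul_smul, ← pow_add, add_comm]
    exact key _ (ih (by omega))

lemma IsGen.socle_eq (h : D.IsGen τ β v) (hβ : β ≠ 0) :
    socle (A := A) V = D.layer v (β - 1) := by
  have : {S : Submodule A V | IsSimpleModule A S} = {D.layer v (β - 1)} := by
    ext S
    rw [Set.mem_ofPred_eq, Set.mem_singleton_iff]
    constructor
    · intro hS
      obtain ⟨r, hr, rfl⟩ := h.exists_eq_layer S
      have h1 := (h.sub hr).length_eq
      rw [Module.length_eq_one] at h1
      have : β - r = 1 := by exact_mod_cast h1.symm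
      congr 1
      omega
    · rintro rfl
      have h1 := h.sub (r := β - 1) (by omega)
      rw [show β - (β - 1) = 1 by omega] at h1
      exact h1.isSimpleModule
  rw [socle, this, sSup_singleton]

/-- The last nonzero vector `x ^ r u` is killed by `x`, and one of its weight components is nonzero.
-/
lemma exists_isGen_of_isSimpleModule [IsSimpleModule A V] : ∃ (τ : ZMod e) (v : V), D.IsGen τ 1 v := by
  classical
  have := IsSimpleModule.nontrivial A V
  obtain ⟨u, hu⟩ := exists_ne (0 : V)
  have hex : ∃ r, D.x ^ r • u = 0 := ⟨N, by rw [D.pow_eq_zero, zero_smul]⟩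
  have h0 : Nat.find hex ≠ 0 := by
    intro h0
    have := Nat.find_spec hex
    rw [h0, pow_zero, one_smul] at this
    exact hu this
  set y := D.x ^ (Nat.find hex - 1) • u
  have hy : y ≠ 0 := Nat.find_min hex (by omega)
  have hxy : D.x • y = 0 := by
    rw [← mul_smul, ← pow_succ', Nat.sub_add_cancel (by omega)]
    exact Nat.find_spec hex
  obtain ⟨τ, hτ⟩ : ∃ τ, D.ε τ • y ≠ 0 := by
    by_contra! hall
    apply hy
    rw [← one_smul A y, ← D.sum_eq_one, Finset.sum_smul]
    exact Finset.sum_eq_zero fun τ _ => hall τ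
  refine ⟨τ, D.ε τ • y, IsGen.mk' _ ?_ ?_ ?_ ?_⟩
  · rw [← mul_smul, D.mul_self]
  · exact IsSimpleModule.span_singleton_eq_top A hτ
  · rw [pow_one, ← mul_smul, ← D.shift, mul_smul, hxy, smul_zero]
  · intro _
    simpa using hτ

lemma isProjectiveCover_of_isUniserial [Module.Projective A V] (hV : IsUniserial A V) [Nontrivial W]
    (f : V →ₗ[A] W) (hf : Function.Surjective f) : IsProjectiveCover f where
  projective := inferInstance
  surjective := hf
  superfluous K hK := by
    rcases hV K (LinearMap.ker f) with h | h
    · rw [sup_eq_right.2 h] at hK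
      obtain ⟨w, hw⟩ := exists_ne (0 : W)
      obtain ⟨u, rfl⟩ := hf w
      exact absurd (LinearMap.mem_ker.1 (hK ▸ Submodule.mem_top)) hw
    · rwa [sup_eq_left.2 h] at hK

lemma IsGen.exists_isProjectiveCover (h : D.IsGen τ N v) (h' : D.IsGen τ 1 w) :
    ∃ f : V →ₗ[A] W, IsProjectiveCover f := by
  have := D.one_lt
  obtain ⟨f, hf⟩ := h.exists_hom h'.weight (by rw [h'.pow_smul_eq_zero_iff]; omega)
  have := h.projective
  have : Nontrivial W := ⟨w, 0, h'.ne_zero one_ne_zero⟩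
  refine ⟨f, isProjectiveCover_of_isUniserial h.isUniserial f ?_⟩
  rw [← LinearMap.range_eq_top, eq_top_iff, ← h'.span, Submodule.span_singleton_le_iff_mem]
  exact ⟨v, hf⟩

variable {ι : Type*} {T : ι → ModuleCat.{w} A} {lab : ι ≃ ZMod e}

lemma IsUni.isU (hT : ∀ i, D.IsUni (lab i) 1 (T i)) {α : ι} (h : D.IsUni (lab α) β V) :
    IsU T α β V := by
  obtain ⟨v, hv⟩ := h
  refine ⟨hv.isUniserial, hv.length_eq, fun hβ => ?_⟩
  rw [hv.socle_eq hβ]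
  have h1 := hv.sub (r := β - 1) (by omega)
  rw [show β - (β - 1) = 1 by omega, Nat.cast_sub (by omega)] at h1
  exact (h1.isUni (s := lab α) (by push_cast; ring)).nonempty_equiv (hT α)

/-- The multiset is expressed through `s` and `β` only, so that modules over two different algebras
get literally the same one. -/
lemma IsUni.hasCompositionFactors (hT : ∀ i, D.IsUni (lab i) 1 (T i)) (h : D.IsUni s β V) :
    HasCompositionFactors T (Finset.univ.val.map fun t : Fin β => lab.symm (s - ((t : ℕ) : ZMod e))) V := by
  obtain ⟨v, hv⟩ := h
  refine ⟨β, fun t => D.layer v (β - t), _, ?_, ?_, fun t => ⟨?_, ?_⟩, rfl⟩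
  · exact hv.layer_eq_bot (by simp)
  · simpa using hv.layer_zero
  · apply layer_anti
    simp only [Fin.val_succ, Fin.val_castSucc]
    omega
  · have ht := t.2
    have h1 := hv.subquot (r := β - (t.succ : ℕ)) (s := β - (t.castSucc : ℕ))
      (by simp only [Fin.val_succ, Fin.val_castSucc]; omega) (by omega)
    have h2 : β - (t.castSucc : ℕ) - (β - (t.succ : ℕ)) = 1 := by
      simp only [Fin.val_succ, Fin.val_castSucc]; omega
    rw [h2] at h1
    refine (h1.isUni (s := s - ((t : ℕ) : ZMod e)) ?_).nonempty_equiv ?_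
    · rw [Nat.cast_sub (by simp only [Fin.val_succ]; omega)]
      simp only [Fin.val_succ]
      push_cast
      ring
    · have := hT (lab.symm (s - ((t : ℕ) : ZMod e)))
      rwa [Equiv.apply_symm_apply] at this

lemma IsGen.factorsIn_iff (hT : ∀ i, D.IsUni (lab i) 1 (T i)) (p : ι → Prop)
    (h : D.IsGen τ β v) :
    FactorsIn T p V ↔ ∀ r < β, p (lab.symm (τ + r)) := by
  constructor
  · intro hF r hr
    have h1 := h.subquot (r := r) (s := r + 1) (by omega) (by omega)
    rw [Nat.add_sub_cancel_left] at h1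
    obtain ⟨α, hα, ⟨f⟩⟩ := hF _ _ (layer_anti v (by omega)) h1.isSimpleModule
    obtain ⟨t, ht⟩ := isUni_one_iff.1 (hT α)
    rwa [((h1.map_equiv f).unique ht one_ne_zero).1, Equiv.symm_apply_apply]
  · intro hp K K' hKK' hS
    obtain ⟨r, hr, rfl⟩ := h.exists_eq_layer K
    obtain ⟨t, ht, rfl⟩ := h.exists_eq_layer K'
    have htr := (h.layer_le_iff ht).1 hKK'
    have h1 := h.subquot htr hr
    have h2 := h1.length_eq
    rw [Module.length_eq_one] at h2
    have h3 : r - t = 1 := by exact_mod_cast h2.symm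
    refine ⟨_, hp t (by omega), ?_⟩
    rw [h3] at h1
    have h4 := hT (lab.symm (τ + t))
    rw [Equiv.apply_symm_apply] at h4
    exact (h1.isUni (by simp)).nonempty_equiv h4

/-- Since `N ≡ 1`, the layers above the submodule of length `b` carry the labels `s - b, s - b - 1,
…` going up. The submodules form a chain, so the largest extension stops just below the first
forbidden label. -/
lemma IsGen.isLargestExtension (hT : ∀ i, D.IsUni (lab i) 1 (T i)) (hN : (N : ZMod e) = 1)
    (p : ι → Prop) (h : D.IsGen s N v) {b γ : ℕ} (hb : b + γ ≤ N)
    (hp : ∀ g < γ, p (lab.symm (s - b - g))) (hp' : ¬ p (lab.symm (s - b - γ))) :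
    IsLargestExtension T p (D.layer v (N - b)) (D.layer v (N - b - γ)) := by
  constructor
  · refine ⟨layer_anti v (by omega), ?_⟩
    rw [(h.subquot (r := N - b - γ) (s := N - b) (by omega) (by omega)).factorsIn_iff hT]
    intro r hr
    have := hp (γ - 1 - r) (by omega)
    convert this using 2
    rw [Nat.sub_sub N, Nat.cast_sub (by omega), Nat.sub_sub γ, Nat.cast_sub (by omega), hN]
    push_cast
    ring
  · rintro M ⟨hLM, hF⟩
    obtain ⟨t, ht, rfl⟩ := h.exists_eq_layer M
    have ht' := (h.layer_le_iff ht).1 hLM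
    apply layer_anti
    by_contra! hlt
    rw [(h.subquot ht' (by omega)).factorsIn_iff hT] at hF
    apply hp'
    have := hF (N - b - γ - t - 1) (by omega)
    convert this using 2
    rw [Nat.sub_sub N, Nat.sub_sub, Nat.sub_sub, Nat.cast_sub (by omega), hN]
    push_cast
    ring

end NakayamaData

/-! ### The algorithm on labels, independent of `N` -/

section Combinatorics

variable {e : ℕ} (q : ZMod e → ℕ)

/-- The number of labels `c, c - 1, …` of perversity less than `j` before the first label of
perversity at least `j`. -/
def gap (j : ℕ) (c : ZMod e) : ℕ := sInf {g : ℕ | j ≤ q (c - g)}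

variable {q}

/-- The witness `t` bounds the gap and rules out the default value `0` of `sInf ∅`. -/
lemma gap_spec {j : ℕ} {c : ZMod e} {t : ℕ} (h : j ≤ q (c - t)) :
    gap q j c ≤ t ∧ j ≤ q (c - gap q j c) ∧ ∀ g < gap q j c, q (c - g) < j :=
  ⟨Nat.sInf_le h, Nat.sInf_mem (s := {g : ℕ | j ≤ q (c - g)}) ⟨t, h⟩,
    fun _ hg => not_le.1 (Nat.notMem_of_lt_sInf (s := {g : ℕ | j ≤ q (c - g)}) hg)⟩

/-- The label below the module with socle `s` and `b` layers (`m` even), or below the Heller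
translate of a module with `b` layers, this translate having socle `s` (`m` odd). -/
def cutLabel (m : ℕ) (p : ZMod e × ℕ) : ZMod e := if Even m then p.1 - p.2 else p.1 - 1 + p.2

variable (q)

/-- After `m` steps of the algorithm for the label `s₀`: the socle `s` of the module reached, and the
number `b` of layers of this module (`m` even) or of its Heller translate `Ω` (`m` odd). -/
def run (s₀ : ZMod e) : ℕ → ZMod e × ℕ
  | 0 => (s₀, 1)
  | m + 1 =>
    (cutLabel m (run s₀ m) - gap q (q s₀ - m) (cutLabel m (run s₀ m)),
      if Even m then (run s₀ m).2 + gap q (q s₀ - m) (cutLabel m (run s₀ m))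
      else (run s₀ m).2 - gap q (q s₀ - m) (cutLabel m (run s₀ m)))

/-- The number of layers added in the step after `m` steps of the algorithm. -/
def runGap (s₀ : ZMod e) (m : ℕ) : ℕ := gap q (q s₀ - m) (cutLabel m (run q s₀ m))

/-- The number of layers of the module reached after `m` steps of the algorithm, if the projective
indecomposable modules have `N` layers. -/
def runLen (s₀ : ZMod e) (N m : ℕ) : ℕ :=
  if Even m then (run q s₀ m).2 else N - (run q s₀ m).2

/-- The socle and the number of layers of the cohomology in degree `-j`. -/
def cohomologyLabel (s₀ : ZMod e) (j : ℕ) : ZMod e × ℕ :=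
  if j = 0 then (s₀, if q s₀ = 0 then 1 else 0)
  else if j = q s₀ then (s₀, 1 + runGap q s₀ 0)
  else if j < q s₀ then (cutLabel (q s₀ - j) (run q s₀ (q s₀ - j)), runGap q s₀ (q s₀ - j))
  else (s₀, 0)

variable {q} {s₀ : ZMod e}

lemma run_succ_fst (m : ℕ) :
    (run q s₀ (m + 1)).1 = cutLabel m (run q s₀ m) - runGap q s₀ m := rfl

/-- Going up, the labels return to the socle `p.1` after `e - b` steps (`m` even, as `s - e = s`) or
`b - 1` steps (`m` odd), where `b = p.2`. So the search for a label of perversity at least `j` ends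
by then. -/
lemma exists_le_perversity {m j : ℕ} {p : ZMod e × ℕ} (h1 : 1 ≤ p.2) (he : p.2 ≤ e)
    (hj : j ≤ q p.1) :
    j ≤ q (cutLabel m p - ((if Even m then e - p.2 else p.2 - 1 : ℕ) : ZMod e)) := by
  unfold cutLabel
  split_ifs
  · rw [Nat.cast_sub he, ZMod.natCast_self]
    simpa using hj
  · rwa [Nat.cast_sub h1, Nat.cast_one, show p.1 - 1 + (p.2 : ZMod e) - (p.2 - 1) = p.1 by ring]

variable [NeZero e]

/-- The new socle is the label that stopped the search, hence its perversity is at least the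
threshold. The bounds `e - b` and `b - 1` on the gap keep the number of layers between `1` and `e`.
-/
lemma run_spec (m : ℕ) (hm : m ≤ q s₀) :
    q s₀ - m ≤ q (run q s₀ m).1 ∧ 1 ≤ (run q s₀ m).2 ∧ (run q s₀ m).2 ≤ e := by
  induction m with
  | zero => exact ⟨le_rfl, le_rfl, NeZero.one_le⟩
  | succ m ih =>
    obtain ⟨h1, h2, h3⟩ := ih (by omega)
    obtain ⟨h4, h5, -⟩ := gap_spec (exists_le_perversity (m := m) h2 h3 h1)
    refine ⟨le_trans (by omega) h5, ?_⟩
    rw [run]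
    dsimp only
    split_ifs at h4 ⊢ <;> omega

lemma runGap_spec {m : ℕ} (hm : m ≤ q s₀) :
    runGap q s₀ m ≤ (if Even m then e - (run q s₀ m).2 else (run q s₀ m).2 - 1) ∧
    ¬ q (cutLabel m (run q s₀ m) - runGap q s₀ m) < q s₀ - m ∧
    ∀ g < runGap q s₀ m, q (cutLabel m (run q s₀ m) - g) < q s₀ - m := by
  obtain ⟨h1, h2, h3⟩ := run_spec m hm
  rw [not_lt]
  exact gap_spec (exists_le_perversity (m := m) h2 h3 h1)

lemma runLen_pos {N m : ℕ} (hN : e < N) (hm : m ≤ q s₀) : 1 ≤ runLen q s₀ N m := by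
  obtain ⟨-, h2, h3⟩ := run_spec m hm
  unfold runLen
  split_ifs <;> omega

/-- The lengths of `L`, `M / L` and `P / M` add up to that of `P`. The additive form can be cast to
`ZMod e` without truncated subtraction. -/
lemma runLen_succ {N m : ℕ} (hN : e < N) (hm : m < q s₀) :
    runLen q s₀ N m + runGap q s₀ m + runLen q s₀ N (m + 1) = N := by
  obtain ⟨-, h2, h3⟩ := run_spec m hm.le
  obtain ⟨-, h2', h3'⟩ := run_spec (m + 1) hm
  obtain ⟨h4, -⟩ := runGap_spec hm.le
  have h5 : (run q s₀ (m + 1)).2 =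
    if Even m then (run q s₀ m).2 + runGap q s₀ m else (run q s₀ m).2 - runGap q s₀ m := rfl
  unfold runLen
  simp only [Nat.even_add_one]
  rw [h5] at h2' h3' ⊢
  split_ifs at * <;> omega

/-- The congruence `N ≡ 1` turns `s - (N - b)` into `s - 1 + b`; this is why `cutLabel` needs no
`N`. -/
lemma cutLabel_run {N m : ℕ} (hN : (N : ZMod e) = 1) (hN' : e < N) (hm : m ≤ q s₀) :
    cutLabel m (run q s₀ m) = (run q s₀ m).1 - runLen q s₀ N m := by
  obtain ⟨-, h2, h3⟩ := run_spec m hm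
  unfold cutLabel runLen
  split_ifs
  · rfl
  · rw [Nat.cast_sub (by omega), hN]
    ring

lemma cohomologyLabel_le (j : ℕ) : (cohomologyLabel q s₀ j).2 ≤ e := by
  have he : 1 ≤ e := NeZero.one_le
  unfold cohomologyLabel
  split_ifs with h1 h2 h3 h4
  · exact he
  · exact Nat.zero_le _
  · have h5 := (runGap_spec (q := q) (s₀ := s₀) (Nat.zero_le _)).1
    rw [if_pos Even.zero, run] at h5
    dsimp only at h5 ⊢
    omega
  · obtain ⟨-, h5, h6⟩ := run_spec (q := q) (s₀ := s₀) (q s₀ - j) (Nat.sub_le _ _)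
    have h7 := (runGap_spec (q := q) (s₀ := s₀) (Nat.sub_le (q s₀) j)).1
    dsimp only
    split_ifs at h7 <;> omega
  · exact Nat.zero_le _

end Combinatorics

/-! ### Terms and cohomology of an arbitrary output -/

section Homology

variable {A : Type u} [Ring A]

lemma nonempty_homology_equiv (X : CochainComplex (ModuleCat.{v} A) ℤ) {a b c : ℤ} (ha : a + 1 = b)
    (hc : b + 1 = c) : Nonempty (X.homology b ≃ₗ[A]
      Subquot (LinearMap.range (X.d a b).hom) (LinearMap.ker (X.d b c).hom)) := by
  have ha' : (ComplexShape.up ℤ).prev b = a := (ComplexShape.up ℤ).prev_eq' ha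
  have hc' : (ComplexShape.up ℤ).next b = c := (ComplexShape.up ℤ).next_eq' hc
  let f := (X.homologyIsoSc' a b c ha' hc' ≪≫ (X.sc' a b c).moduleCatHomologyIso).toLinearEquiv
  refine ⟨f.trans (Submodule.quotEquivOfEq _ _ ?_)⟩
  exact LinearMap.range_codRestrict _ _ _

end Homology

namespace NakayamaData

variable {k : Type*} [Field k] {A : Type u} [Ring A] [Algebra k A] {e N : ℕ} [NeZero e]
variable {D : NakayamaData k A e N}
variable {ι : Type*} {T : ι → ModuleCat.{u} A} {lab : ι ≃ ZMod e} {π : ι → ℕ} {i : ι}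

lemma IsGen.range_isUni {V : Type*} [AddCommGroup V] [Module A V] {W : Type*} [AddCommGroup W]
    [Module A W] {τ s : ZMod e} {v : V} (h : D.IsGen τ N v) (f : V →ₗ[A] W) {r : ℕ} (hr : r ≤ N)
    (hf : LinearMap.ker f = D.layer v r) (hs : τ = s - r + 1) :
    D.IsUni s r (LinearMap.range f) := by
  have h1 := h.quotient hr
  rw [← hf] at h1
  exact (h1.map_equiv f.quotKerEquivRange).isUni hs

section Output

variable {X : CochainComplex (ModuleCat.{u} A) ℤ}

/-- The left side is the top of the projective `P`, which equals its socle. It is also the top of `P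
/ M`, whose socle and length appear on the right. -/
lemma run_eq_sub (hN : (N : ZMod e) = 1) (heN : e < N) {q : ZMod e → ℕ} {s₀ : ZMod e} {m : ℕ}
    (hm : m < q s₀) :
    (run q s₀ m).1 = (run q s₀ (m + 1)).1 - runLen q s₀ N (m + 1) + 1 := by
  have h1 := congrArg (Nat.cast (R := ZMod e)) (runLen_succ heN hm)
  push_cast at h1
  rw [hN] at h1
  rw [run_succ_fst, cutLabel_run hN heN hm.le]
  linear_combination h1

/-- The submodules appearing in the successive terms of the output of the algorithm. -/
lemma exists_isGen_of_isAlgorithmOutput (hT : ∀ i, D.IsUni (lab i) 1 (T i))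
    (hN : (N : ZMod e) = 1) (heN : e < N) (hX : IsAlgorithmOutput T π i X) (m : ℕ) :
    ∀ j : ℕ, m + j = π i → 0 < j → ∀ a b c : ℤ, a = -j - 1 → b = -j → c = -j + 1 →
    ∃ v : X.X b, D.IsGen (run (π ∘ lab.symm) (lab i) m).1 N v ∧
      LinearMap.range (X.d a b).hom = D.layer v (if m = 0 then N else
        N - runLen (π ∘ lab.symm) (lab i) N m) ∧
      LinearMap.ker (X.d b c).hom = D.layer v (N - runLen (π ∘ lab.symm) (lab i) N m -
        runGap (π ∘ lab.symm) (lab i) m) := by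
  have hq : (π ∘ lab.symm) (lab i) = π i := by simp
  set q := π ∘ lab.symm
  induction m with
  | zero =>
    rintro j hj hj0 a b c rfl rfl rfl
    rw [zero_add] at hj
    subst hj
    obtain ⟨f, hf, hull, hlarge⟩ := hX.first hj0
    have h1 := (hT i).congr (LinearEquiv.ofInjective f hf)
    obtain ⟨v, hv, hL⟩ := h1.exists_isGen_of_isInjectiveHull hN hull one_ne_zero
    have h2 := runLen_succ (q := q) (s₀ := lab i) (m := 0) heN (by omega)
    obtain ⟨-, h3, h4⟩ := runGap_spec (q := q) (s₀ := lab i) (m := 0) (by omega)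
    have hlen : runLen q (lab i) N 0 = 1 := rfl
    refine ⟨v, hv, ?_, ?_⟩
    -- In the lowest degree the incoming differential is zero, whereas `L` is the image of `T i`;
    -- hence the exceptional exponent `N` at `m = 0`.
    · rw [if_pos rfl, hv.layer_eq_bot le_rfl, LinearMap.range_eq_bot]
      have : X.d (-(π i : ℤ) - 1) (-(π i : ℤ)) = 0 :=
        (hX.isZero _ (Or.inl (by omega))).eq_of_src _ _
      rw [this, ModuleCat.hom_zero]
    · rw [hL] at hlarge
      refine hlarge.unique ?_
      rw [hlen] at h2 ⊢
      simp only [cutLabel_run hN heN (Nat.zero_le (q (lab i))), hlen, Nat.sub_zero, hq] at h3 h4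
      exact hv.isLargestExtension hT hN _ (by omega) h4 h3
  | succ m ih =>
    rintro j hj hj0 a b c rfl rfl rfl
    -- The degrees are variables constrained by equations, so that the previous step can be used at
    -- syntactically different integers without transport along `X.X`.
    obtain ⟨u, hu, -, hk⟩ := ih (j + 1) (by omega) (by omega) (-j - 1 - 1) (-j - 1) (-j)
      (by push_cast; ring) (by push_cast; ring) (by push_cast; ring)
    have h1 := runLen_succ (q := q) (s₀ := lab i) (m := m) heN (by omega)
    have h2 := runLen_succ (q := q) (s₀ := lab i) (m := m + 1) heN (by omega)
    have hpos := runLen_pos (q := q) (s₀ := lab i) (m := m + 1) heN (by omega)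
    obtain ⟨-, h3, h4⟩ := runGap_spec (q := q) (s₀ := lab i) (m := m + 1) (by omega)
    have h5 : D.IsUni (run q (lab i) (m + 1)).1 (runLen q (lab i) N (m + 1))
        (LinearMap.range (X.d (-j - 1) (-j)).hom) := by
      refine hu.range_isUni _ (by omega) ?_ (run_eq_sub hN heN (by omega))
      rw [hk]
      congr 1
      omega
    obtain ⟨hull, hlarge⟩ := hX.step j hj0 (by omega)
    obtain ⟨v, hv, hL⟩ := h5.exists_isGen_of_isInjectiveHull hN hull (by omega)
    refine ⟨v, hv, by rw [if_neg (by omega), hL], ?_⟩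
    rw [hL] at hlarge
    refine hlarge.unique ?_
    simp only [cutLabel_run (m := m + 1) hN heN (show m + 1 ≤ q (lab i) by omega), hq,
      show π i - (m + 1) = j by omega] at h3 h4
    exact hv.isLargestExtension hT hN _ (by omega) h4 h3

lemma isUni_degree_zero (hT : ∀ i, D.IsUni (lab i) 1 (T i))
    (hN : (N : ZMod e) = 1) (heN : e < N) (hX : IsAlgorithmOutput T π i X) :
    D.IsUni (run (π ∘ lab.symm) (lab i) (π i)).1 (runLen (π ∘ lab.symm) (lab i) N (π i)) (X.X 0) := by
  have hq : (π ∘ lab.symm) (lab i) = π i := by simp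
  rcases hπ : π i with _ | m
  · obtain ⟨f⟩ := hX.trivial hπ
    exact (hT i).congr f.symm
  · obtain ⟨u, hu, -, hk⟩ := exists_isGen_of_isAlgorithmOutput hT hN heN hX m 1 (by omega) one_pos
      (-2) (-1) 0 rfl rfl rfl
    have h1 := runLen_succ (q := π ∘ lab.symm) (s₀ := lab i) (m := m) heN (by omega)
    have h2 := hu.range_isUni _ (r := runLen (π ∘ lab.symm) (lab i) N (m + 1)) (by omega)
      (by rw [hk]; congr 1; omega) (run_eq_sub hN heN (by omega))
    exact h2.congr (LinearEquiv.ofTop _ (LinearMap.range_eq_top.2 (hX.last (by omega))))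

/-- For `0 < j < π i` the cohomology is `M_j / L_{j+1}`: its length is the gap, and its socle is the
first label above `L_{j+1}`. In degree `0` it vanishes when `π i > 0`, as the last differential is
onto. -/
lemma isUni_homology (hT : ∀ i, D.IsUni (lab i) 1 (T i))
    (hN : (N : ZMod e) = 1) (heN : e < N) (hX : IsAlgorithmOutput T π i X) (j : ℕ) :
    D.IsUni (cohomologyLabel (π ∘ lab.symm) (lab i) j).1
      (cohomologyLabel (π ∘ lab.symm) (lab i) j).2 (X.homology (-(j : ℤ))) := by
  have hq : (π ∘ lab.symm) (lab i) = π i := by simp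
  obtain ⟨f⟩ := nonempty_homology_equiv X (a := -(j : ℤ) - 1) (b := -j) (c := -j + 1)
    (by ring) rfl
  refine IsUni.congr ?_ f.symm
  have hout : ∀ {a b : ℤ} (h : a < -(π i : ℤ) ∨ 0 < a), X.d a b = 0 := fun h =>
    (hX.isZero _ h).eq_of_src _ _
  rcases Nat.lt_or_ge (π i) j with hj | hj
  · -- outside the support
    have h0 : cohomologyLabel (π ∘ lab.symm) (lab i) j = (lab i, 0) := by
      rw [cohomologyLabel, hq, if_neg (by omega), if_neg (by omega), if_neg (by omega)]
    rw [h0]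
    have := ModuleCat.subsingleton_of_isZero (hX.isZero (-(j : ℤ)) (Or.inl (by omega)))
    exact isUni_zero
  rcases Nat.eq_zero_or_pos j with rfl | hj0
  · have hd : LinearMap.ker (X.d (-((0 : ℕ) : ℤ)) (-((0 : ℕ) : ℤ) + 1)).hom = ⊤ := by
      have : X.d (-((0 : ℕ) : ℤ)) (-((0 : ℕ) : ℤ) + 1) = 0 :=
        (hX.isZero _ (Or.inr (by simp))).eq_of_tgt _ _
      rw [this, ModuleCat.hom_zero, LinearMap.ker_zero]
    by_cases hπ : π i = 0
    · have h0 : cohomologyLabel (π ∘ lab.symm) (lab i) 0 = (lab i, 1) := by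
        rw [cohomologyLabel, hq, if_pos rfl, if_pos hπ]
      have hr : LinearMap.range (X.d (-((0 : ℕ) : ℤ) - 1) (-((0 : ℕ) : ℤ))).hom = ⊥ := by
        rw [hout (Or.inl (by simp [hπ])), ModuleCat.hom_zero, LinearMap.range_zero]
      rw [h0, hd, hr]
      obtain ⟨g⟩ := hX.trivial hπ
      have h1 : D.IsUni (lab i) 1 (⊤ : Submodule A (X.X (-((0 : ℕ) : ℤ)))) :=
        ((hT i).congr g.symm).congr (LinearEquiv.ofTop _ rfl).symm
      exact h1.congr (Submodule.quotEquivOfEqBot _ (by simp [Submodule.submoduleOf])).symm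
    · have h0 : cohomologyLabel (π ∘ lab.symm) (lab i) 0 = (lab i, 0) := by
        rw [cohomologyLabel, hq, if_pos rfl, if_neg hπ]
      have hr : LinearMap.range (X.d (-((0 : ℕ) : ℤ) - 1) (-((0 : ℕ) : ℤ))).hom = ⊤ :=
        LinearMap.range_eq_top.2 (hX.last (by omega))
      rw [h0, hd, hr]
      have : Subsingleton (Subquot (⊤ : Submodule A (X.X (-((0 : ℕ) : ℤ)))) ⊤) := by
        rw [Submodule.Quotient.subsingleton_iff]
        simp [Submodule.submoduleOf]
      exact isUni_zero
  obtain ⟨v, hv, hr, hk⟩ := exists_isGen_of_isAlgorithmOutput hT hN heN hX (π i - j) j (by omega) hj0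
    _ _ _ rfl rfl rfl
  have h1 := runLen_succ (q := π ∘ lab.symm) (s₀ := lab i) (m := π i - j) heN (by omega)
  rw [hr, hk]
  -- In degree `-π i` nothing is factored out, so `T i` itself counts as the extra layer in `1 +
  -- gap`.
  by_cases hjπ : j = π i
  · have h0 : cohomologyLabel (π ∘ lab.symm) (lab i) j =
        (lab i, 1 + runGap (π ∘ lab.symm) (lab i) 0) := by
      rw [cohomologyLabel, hq, if_neg (by omega), if_pos hjπ]
    have hm : π i - j = 0 := by omega
    rw [hm] at hv h1 ⊢
    have hlen : runLen (π ∘ lab.symm) (lab i) N 0 = 1 := rfl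
    rw [hlen] at h1 ⊢
    rw [h0, if_pos rfl]
    have h2 := hv.subquot (r := N - 1 - runGap (π ∘ lab.symm) (lab i) 0) (s := N) (by omega) le_rfl
    rw [show N - (N - 1 - runGap (π ∘ lab.symm) (lab i) 0) =
      1 + runGap (π ∘ lab.symm) (lab i) 0 by omega] at h2
    refine h2.isUni ?_
    rw [Nat.sub_sub, Nat.cast_sub (by omega), hN, run]
    ring
  · have h0 : cohomologyLabel (π ∘ lab.symm) (lab i) j =
        (cutLabel (π i - j) (run (π ∘ lab.symm) (lab i) (π i - j)),
          runGap (π ∘ lab.symm) (lab i) (π i - j)) := by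
      rw [cohomologyLabel, hq, if_neg (by omega), if_neg (by omega), if_pos (by omega)]
    rw [h0, if_neg (by omega), cutLabel_run hN heN (by omega)]
    have h2 := hv.subquot (r := N - runLen (π ∘ lab.symm) (lab i) N (π i - j) -
      runGap (π ∘ lab.symm) (lab i) (π i - j)) (s := N - runLen (π ∘ lab.symm) (lab i) N (π i - j))
      (by omega) (by omega)
    rw [Nat.sub_sub_self (by omega)] at h2
    refine h2.isUni ?_
    rw [Nat.sub_sub, Nat.cast_sub (by omega), hN]
    push_cast
    ring

end Output

end NakayamaData

/-! ### Existence of an output: left ideals and right multiplications -/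

section RightMul

variable {A : Type u} [Ring A]

/-- Right multiplication by `y`, from the left ideal `A w` to the left ideal `A w'`. -/
def rightMul (w w' y : A) (h : w * y ∈ Submodule.span A {w'}) :
    Submodule.span A {w} →ₗ[A] Submodule.span A {w'} :=
  (LinearMap.toSpanSingleton A A y).restrict fun a ha => by
    obtain ⟨b, rfl⟩ := Submodule.mem_span_singleton.1 ha
    rw [LinearMap.toSpanSingleton_apply, smul_eq_mul, smul_eq_mul, mul_assoc]
    exact Submodule.smul_mem _ b h

lemma coe_rightMul (w w' y : A) (h : w * y ∈ Submodule.span A {w'}) (a : Submodule.span A {w}) :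
    (rightMul w w' y h a : A) = a * y := rfl

lemma range_rightMul (w w' y : A) (h : w * y ∈ Submodule.span A {w'}) :
    LinearMap.range (rightMul w w' y h) = Submodule.span A {⟨w * y, h⟩} := by
  apply le_antisymm
  · rintro _ ⟨⟨a, ha⟩, rfl⟩
    obtain ⟨b, rfl⟩ := Submodule.mem_span_singleton.1 ha
    refine Submodule.mem_span_singleton.2 ⟨b, Subtype.ext ?_⟩
    rw [coe_rightMul]
    simp [mul_assoc]
  · rw [Submodule.span_singleton_le_iff_mem]
    exact ⟨⟨w, Submodule.mem_span_singleton_self w⟩, rfl⟩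

/-- The complex with terms the left ideals `A w z` and differentials the right
multiplications by `y z`. -/
def rightMulComplex (w y : ℤ → A) (h : ∀ z, w z * y z ∈ Submodule.span A {w (z + 1)})
    (h' : ∀ z, w z * y z * y (z + 1) = 0) : CochainComplex (ModuleCat.{u} A) ℤ :=
  CochainComplex.of (fun z => ModuleCat.of A (Submodule.span A {w z}))
    (fun z => ModuleCat.ofHom (rightMul (w z) (w (z + 1)) (y z) (h z))) fun z => by
      ext ⟨a, ha⟩
      obtain ⟨b, rfl⟩ := Submodule.mem_span_singleton.1 ha
      change b * w z * y z * y (z + 1) = 0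
      rw [mul_assoc b, mul_assoc b, h', mul_zero]

lemma rightMulComplex_d (w y : ℤ → A) (h : ∀ z, w z * y z ∈ Submodule.span A {w (z + 1)})
    (h' : ∀ z, w z * y z * y (z + 1) = 0) (z : ℤ) :
    ((rightMulComplex w y h h').d z (z + 1)).hom = rightMul (w z) (w (z + 1)) (y z) (h z) :=
  congrArg ModuleCat.Hom.hom
    (CochainComplex.of_d (fun z => ModuleCat.of A (Submodule.span A {w z}))
      (fun z => ModuleCat.ofHom (rightMul (w z) (w (z + 1)) (y z) (h z))) z)

lemma range_rightMulComplex_d (w y : ℤ → A) (h : ∀ z, w z * y z ∈ Submodule.span A {w (z + 1)})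
    (h' : ∀ z, w z * y z * y (z + 1) = 0) {a b : ℤ} (hab : a + 1 = b) {t : A}
    (ht : t ∈ Submodule.span A {w b}) (hwt : w a * y a = t) :
    LinearMap.range ((rightMulComplex w y h h').d a b).hom =
      Submodule.span A {(⟨t, ht⟩ : Submodule.span A {w b})} := by
  subst hab hwt
  rw [rightMulComplex_d]
  exact range_rightMul _ _ _ _

end RightMul

namespace NakayamaData

/-- The exponents of the powers of `x` by which the differentials multiply. -/
def outputExp {e : ℕ} (N : ℕ) (q : ZMod e → ℕ) (s₀ : ZMod e) (z : ℤ) : ℕ :=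
  if -(q s₀ : ℤ) ≤ z ∧ z < 0 then
    runLen q s₀ N (q s₀ + z).toNat + runGap q s₀ (q s₀ + z).toNat else N

lemma outputExp_neg {e N : ℕ} {q : ZMod e → ℕ} {s₀ : ZMod e} {m j : ℕ} (hj : 0 < j) (hm : m + j = q s₀) {z : ℤ} (hz : z = -j) :
    outputExp N q s₀ z = runLen q s₀ N m + runGap q s₀ m := by
  rw [outputExp, if_pos (by omega), show (q s₀ + z).toNat = m by omega]

variable {k : Type*} [Field k] {A : Type u} [Ring A] [Algebra k A] {e N : ℕ} [NeZero e]
variable {D : NakayamaData k A e N}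

variable (D) in
lemma isGen_span_pow (τ : ZMod e) {r : ℕ} (hr : r < N) :
    D.IsGen (τ + r) (N - r) (⟨D.x ^ r * D.ε τ, Submodule.mem_span_singleton_self _⟩ :
      Submodule.span A {D.x ^ r * D.ε τ}) := by
  apply IsGen.mk'
  · apply Subtype.ext
    change D.ε (τ + r) * (D.x ^ r * D.ε τ) = _
    rw [ε_mul_pow, if_pos rfl]
  · exact span_singleton_mk_eq_top _
  · apply Subtype.ext
    change D.x ^ (N - r) * (D.x ^ r * D.ε τ) = 0
    rw [← mul_assoc, ← pow_add, Nat.sub_add_cancel hr.le, D.pow_eq_zero, zero_mul]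
  · intro _ h0
    have h1 : D.x ^ (N - r - 1) * (D.x ^ r * D.ε τ) = 0 := congrArg Subtype.val h0
    rw [← mul_assoc, ← pow_add, show N - r - 1 + r = N - 1 by omega] at h1
    exact D.pow_mul_ne_zero τ h1

/-- The element `p(x) ε τ` goes to `p(x) x ^ r ε τ'`, which vanishes exactly when `X ^ N ∣ p X ^ r`.
-/
lemma ker_rightMul (τ τ' : ZMod e) {r : ℕ} (hr : r ≤ N) (hτ : τ = τ' + r) (w' : A)
    (h : D.ε τ * D.x ^ r ∈ Submodule.span A {w'}) :
    LinearMap.ker (rightMul (D.ε τ) w' (D.x ^ r) h) =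
      D.layer (⟨D.ε τ, Submodule.mem_span_singleton_self _⟩ : Submodule.span A {D.ε τ}) (N - r) := by
  have h1 := isGen_ideal (D := D) τ
  have h2 := isGen_ideal (D := D) τ'
  set v : Submodule.span A {D.ε τ} := ⟨D.ε τ, Submodule.mem_span_singleton_self _⟩
  ext u
  obtain ⟨p, rfl⟩ := h1.exists_eq u
  rw [h1.mem_layer (by omega), LinearMap.mem_ker, ← Submodule.coe_eq_zero, coe_rightMul]
  have h3 := h2.ann (p * X ^ r)
  rw [← Submodule.coe_eq_zero] at h3
  have h4 : ((aeval D.x p • v : Submodule.span A {D.ε τ}) : A) * D.x ^ r =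
      aeval D.x (p * X ^ r) * D.ε τ' := by
    change aeval D.x p * D.ε τ * D.x ^ r = _
    rw [mul_assoc, hτ, D.shift_nat]
    simp [mul_assoc]
  rw [h4]
  refine h3.trans ?_
  nth_rw 1 [← Nat.sub_add_cancel hr]
  rw [pow_add]
  exact mul_dvd_mul_iff_right (pow_ne_zero r X_ne_zero)

variable (D) (q : ZMod e → ℕ) (s₀ : ZMod e)

/-- The generators of the left ideals which are the terms of the output of the algorithm. -/
def outputGen (z : ℤ) : A :=
  if z = 0 then D.x ^ (N - runLen q s₀ N (q s₀)) * D.ε (run q s₀ (q s₀)).1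
  else if -(q s₀ : ℤ) ≤ z ∧ z < 0 then D.ε (run q s₀ (q s₀ + z).toNat).1 else 0

variable {q s₀}

lemma outputGen_neg {m j : ℕ} (hj : 0 < j) (hm : m + j = q s₀) {z : ℤ} (hz : z = -j) :
    D.outputGen q s₀ z = D.ε (run q s₀ m).1 := by
  rw [outputGen, if_neg (by omega), if_pos (by omega),
    show (q s₀ + z).toNat = m by omega]

lemma run_eq_add (hN : (N : ZMod e) = 1) (heN : e < N) {m : ℕ} (hm : m < q s₀) :
    (run q s₀ m).1 = (run q s₀ (m + 1)).1 + (runLen q s₀ N m + runGap q s₀ m : ℕ) := by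
  rw [run_succ_fst, cutLabel_run hN heN hm.le]
  push_cast
  ring

/-- The differential sends the generator of a projective to the generator of the submodule of length
`runLen (m + 1)` in the next projective. When `j = 0` this image generates the whole degree-zero
term. -/
lemma outputGen_mul (hN : (N : ZMod e) = 1) (heN : e < N) {m j : ℕ} (hm : m + (j + 1) = q s₀)
    {z : ℤ} (hz : z = -(j : ℤ) - 1) : D.outputGen q s₀ z * D.x ^ outputExp N q s₀ z =
      D.x ^ (N - runLen q s₀ N (m + 1)) * D.ε (run q s₀ (m + 1)).1 := by
  have h1 := runLen_succ (q := q) (s₀ := s₀) (m := m) heN (by omega)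
  rw [D.outputGen_neg (Nat.succ_pos j) hm (by push_cast; omega),
    outputExp_neg (Nat.succ_pos j) hm (by push_cast; omega), run_eq_add hN heN (by omega),
    D.shift_nat, Nat.eq_sub_of_add_eq h1]

lemma outputGen_mul_mem (hN : (N : ZMod e) = 1) (heN : e < N) (z : ℤ) :
    D.outputGen q s₀ z * D.x ^ outputExp N q s₀ z ∈
      Submodule.span A {D.outputGen q s₀ (z + 1)} := by
  by_cases hz : -(q s₀ : ℤ) ≤ z ∧ z < 0
  · obtain ⟨j, rfl⟩ : ∃ j : ℕ, z = -(j : ℤ) - 1 := ⟨(-z - 1).toNat, by omega⟩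
    obtain ⟨m, hm⟩ : ∃ m : ℕ, m + (j + 1) = q s₀ := ⟨q s₀ - (j + 1), by omega⟩
    rw [D.outputGen_mul hN heN hm rfl]
    rcases Nat.eq_zero_or_pos j with rfl | hj
    · rw [outputGen, if_pos (by simp), ← hm]
      exact Submodule.mem_span_singleton_self _
    · rw [D.outputGen_neg (m := m + 1) hj (by omega) (by ring)]
      exact Submodule.smul_mem _ _ (Submodule.mem_span_singleton_self _)
  · rw [outputExp, if_neg hz, D.pow_eq_zero, mul_zero]
    exact Submodule.zero_mem _

/-- Two consecutive exponents add up to at least `N`: inside the range this is `runLen_succ`, and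
otherwise one of them is `N` by definition. -/
lemma outputGen_mul_mul (heN : e < N) (z : ℤ) :
    D.outputGen q s₀ z * D.x ^ outputExp N q s₀ z * D.x ^ outputExp N q s₀ (z + 1) = 0 := by
  rw [mul_assoc, ← pow_add]
  by_cases hz : -(q s₀ : ℤ) ≤ z ∧ z < -1
  · have h1 := runLen_succ (q := q) (s₀ := s₀) (m := (q s₀ + z).toNat) heN (by omega)
    rw [outputExp, if_pos (by omega), outputExp, if_pos (by omega),
      show (q s₀ + (z + 1)).toNat = (q s₀ + z).toNat + 1 by omega,
      D.pow_eq_zero_of_le (by omega), mul_zero]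
  · have h1 : outputExp N q s₀ z = N ∨ outputExp N q s₀ (z + 1) = N := by
      unfold outputExp
      by_cases hz' : -(q s₀ : ℤ) ≤ z ∧ z < 0
      · right
        rw [if_neg (by omega)]
      · left
        rw [if_neg hz']
    rw [D.pow_eq_zero_of_le (by omega), mul_zero]

variable {ι : Type*} {T : ι → ModuleCat.{u} A} {lab : ι ≃ ZMod e}

lemma exists_isAlgorithmOutput (hT : ∀ i, D.IsUni (lab i) 1 (T i))
    (hN : (N : ZMod e) = 1) (heN : e < N) (π : ι → ℕ) (i : ι) :
    ∃ X, IsAlgorithmOutput T π i X := by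
  have hq : (π ∘ lab.symm) (lab i) = π i := by simp
  set q := π ∘ lab.symm
  set s₀ := lab i
  have h1 := D.outputGen_mul_mem (q := q) (s₀ := s₀) hN heN
  have h2 := D.outputGen_mul_mul (q := q) (s₀ := s₀) heN
  -- the kernels, and the layers of the negative terms
  have hker : ∀ m j : ℕ, m + j = π i → 0 < j → ∀ z : ℤ, z = -j →
      ∃ v : Submodule.span A {D.outputGen q s₀ z}, (v : A) = D.ε (run q s₀ m).1 ∧
        D.IsGen (run q s₀ m).1 N v ∧
        LinearMap.ker ((rightMulComplex _ _ h1 h2).d z (z + 1)).hom =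
          D.layer v (N - runLen q s₀ N m - runGap q s₀ m) ∧
        IsLargestExtension T (fun α => π α < j) (D.layer v (N - runLen q s₀ N m))
          (D.layer v (N - runLen q s₀ N m - runGap q s₀ m)) := by
    intro m j hm hj z hz
    have h3 := runLen_succ (q := q) (s₀ := s₀) (m := m) heN (by omega)
    obtain ⟨-, h4, h5⟩ := runGap_spec (q := q) (s₀ := s₀) (m := m) (by omega)
    simp only [cutLabel_run (m := m) hN heN (show m ≤ q s₀ by omega), hq,
      show π i - m = j by omega] at h4 h5
    have h6 := h1 z
    rw [D.outputGen_neg hj (hm.trans hq.symm) hz, outputExp_neg hj (hm.trans hq.symm) hz] at h6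
    have h7 := ker_rightMul _ _ (by omega) (run_eq_add hN heN (by omega)) _ h6
    have h8 := isGen_ideal (D := D) (run q s₀ m).1
    -- The generator and the exponent equal their expected values only propositionally, and the type
    -- of the term depends on the generator; both are generalized so that the equations can be
    -- substituted.
    have h9 : ∀ (w : A) (r : ℕ) (hw : w = D.ε (run q s₀ m).1)
        (hr : r = runLen q s₀ N m + runGap q s₀ m)
        (h : w * D.x ^ r ∈ Submodule.span A {D.outputGen q s₀ (z + 1)}),
        ∃ v : Submodule.span A {w}, (v : A) = D.ε (run q s₀ m).1 ∧
        D.IsGen (run q s₀ m).1 N v ∧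
        LinearMap.ker (rightMul w _ (D.x ^ r) h) =
          D.layer v (N - runLen q s₀ N m - runGap q s₀ m) ∧
        IsLargestExtension T (fun α => π α < j) (D.layer v (N - runLen q s₀ N m))
          (D.layer v (N - runLen q s₀ N m - runGap q s₀ m)) := by
      rintro w r rfl rfl h
      refine ⟨_, rfl, h8, ?_, h8.isLargestExtension hT hN _ (by omega) h5 h4⟩
      rw [h7, Nat.sub_sub]
    rw [rightMulComplex_d]
    exact h9 _ _ (D.outputGen_neg hj (hm.trans hq.symm) hz) (outputExp_neg hj (hm.trans hq.symm) hz) _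
  refine ⟨rightMulComplex _ _ h1 h2, ?_, ?_, ?_, ?_, ?_⟩
  · intro z hz
    have h3 : D.outputGen q s₀ z = 0 := by
      rw [outputGen, if_neg (by omega), if_neg (by omega)]
    have h4 : Subsingleton (Submodule.span A {D.outputGen q s₀ z}) := by
      rw [h3, Submodule.span_zero_singleton]
      infer_instance
    exact @ModuleCat.isZero_of_subsingleton A _
      (ModuleCat.of A (Submodule.span A {D.outputGen q s₀ z})) h4
  · intro hπ
    -- For `π i = 0` the only term is the socle of `A ε s₀`, which has weight `s₀` because `N ≡ 1`.
    have h3 : D.outputGen q s₀ 0 = D.x ^ (N - 1) * D.ε s₀ := by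
      rw [outputGen, if_pos rfl, hq, hπ]
      rfl
    have h4 : ∀ w, w = D.x ^ (N - 1) * D.ε s₀ → D.IsUni s₀ 1 (Submodule.span A {w}) := by
      rintro w rfl
      have h5 := D.isGen_span_pow s₀ (r := N - 1) (by have := D.one_lt; omega)
      have h6 : N - (N - 1) = 1 := by have := D.one_lt; omega
      rw [h6, Nat.cast_sub D.one_lt.le, hN, Nat.cast_one, sub_self, add_zero] at h5
      exact h5.isUni (by simp)
    exact (h4 _ h3).nonempty_equiv (hT i)
  · intro hπ
    obtain ⟨v, -, hv, hk, hl⟩ := hker 0 (π i) (zero_add _) hπ _ rfl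
    have hlen : runLen q s₀ N 0 = 1 := rfl
    rw [hlen] at hk hl
    have h3 := hv.sub (r := N - 1) (by omega)
    rw [Nat.sub_sub_self D.one_lt.le, Nat.cast_sub D.one_lt.le, hN, Nat.cast_one, sub_self,
      add_zero] at h3
    obtain ⟨f⟩ := (hT i).nonempty_equiv (h3.isUni (s := s₀) (by rw [run]; simp))
    have h4 : LinearMap.range ((D.layer v (N - 1)).subtype ∘ₗ f.toLinearMap) = D.layer v (N - 1) := by
      rw [LinearMap.range_comp, LinearEquiv.range, Submodule.map_top, Submodule.range_subtype]
    have h5 : ∀ K, K = D.layer v (N - 1) → IsInjectiveHull K ∧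
        IsLargestExtension T (fun α => π α < π i) K (D.layer v (N - 1 - runGap q s₀ 0)) := by
      rintro _ rfl
      exact ⟨hv.isInjectiveHull (by have := D.one_lt; omega), hl⟩
    refine ⟨(D.layer v (N - 1)).subtype ∘ₗ f.toLinearMap,
      (Submodule.injective_subtype _).comp f.injective, (h5 _ h4).1, ?_⟩
    rw [hk]
    exact (h5 _ h4).2
  · intro j hj hjπ
    obtain ⟨m, hm⟩ : ∃ m, m + (j + 1) = π i := ⟨π i - (j + 1), by omega⟩
    obtain ⟨v, hv, hv', hk, hl⟩ := hker (m + 1) j (by omega) hj _ rfl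
    have hpos := runLen_pos (q := q) (s₀ := s₀) (m := m + 1) heN (by omega)
    have h3 : LinearMap.range ((rightMulComplex _ _ h1 h2).d (-(j : ℤ) - 1) (-(j : ℤ))).hom =
        D.layer v (N - runLen q s₀ N (m + 1)) := by
      refine range_rightMulComplex_d _ _ h1 h2 (by ring)
        (D.x ^ (N - runLen q s₀ N (m + 1)) • v).2 ?_
      rw [D.outputGen_mul hN heN (hm.trans hq.symm) rfl, Submodule.coe_smul, hv, smul_eq_mul]
    rw [h3, hk]
    exact ⟨hv'.isInjectiveHull (by omega), hl⟩
  · intro hπ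
    obtain ⟨m, hm⟩ : ∃ m, m + (0 + 1) = π i := ⟨π i - 1, by omega⟩
    rw [← LinearMap.range_eq_top]
    have h3 : D.outputGen q s₀ (-1) * D.x ^ outputExp N q s₀ (-1) = D.outputGen q s₀ 0 := by
      rw [D.outputGen_mul (z := -1) hN heN (hm.trans hq.symm) rfl, outputGen, if_pos rfl, hq, ← hm]
    exact (range_rightMulComplex_d _ _ h1 h2 rfl (Submodule.mem_span_singleton_self _) h3).trans
      (span_singleton_mk_eq_top _)

end NakayamaData

/-! ### Group algebras of semidirect products are Nakayama algebras -/

section CompositionInverse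

variable {k : Type*} [Field k]

lemma exists_eq_X_mul {F : k[X]} (h0 : F.coeff 0 = 0) (h1 : F.coeff 1 = 1) :
    ∃ u : k[X], F = X * u ∧ u.coeff 0 = 1 := by
  obtain ⟨u, rfl⟩ := X_dvd_iff.2 h0
  exact ⟨u, rfl, by rwa [coeff_X_mul] at h1⟩

/-- A power series in `X` is a power series in `F = X + ⋯`, up to any order. -/
lemma exists_X_pow_dvd_comp_sub {F : k[X]} (h0 : F.coeff 0 = 0) (h1 : F.coeff 1 = 1) (g : k[X])
    (n : ℕ) : ∃ p : k[X], X ^ n ∣ p.comp F - g := by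
  obtain ⟨u, rfl, hu⟩ := exists_eq_X_mul h0 h1
  induction n with
  | zero => exact ⟨0, by simp⟩
  | succ n ih =>
    obtain ⟨p, r, hr⟩ := ih
    -- Since `F ^ n` begins with `X ^ n`, subtracting this multiple of it removes the error in
    -- degree `n`.
    refine ⟨p - C (r.coeff 0) * X ^ n, ?_⟩
    have h2 : (p - C (r.coeff 0) * X ^ n).comp (X * u) - g =
        X ^ n * (r - C (r.coeff 0) * u ^ n) := by
      rw [sub_comp, mul_comp, C_comp, pow_comp, X_comp, sub_right_comm, hr]
      ring
    rw [h2, pow_succ]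
    refine mul_dvd_mul_left _ (X_dvd_iff.2 ?_)
    rw [coeff_sub, coeff_C_mul, coeff_zero_eq_eval_zero (u ^ n), eval_pow,
      ← coeff_zero_eq_eval_zero, hu, one_pow, mul_one, sub_self]

lemma X_pow_dvd_pow_sub {F : k[X]} (h0 : F.coeff 0 = 0) (h1 : F.coeff 1 = 1) (n : ℕ) :
    X ^ (n + 1) ∣ F ^ n - X ^ n := by
  obtain ⟨u, rfl, hu⟩ := exists_eq_X_mul h0 h1
  have h2 : (X * u) ^ n - X ^ n = X ^ n * (u ^ n - 1) := by ring
  rw [h2, pow_succ]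
  refine mul_dvd_mul_left _ (X_dvd_iff.2 ?_)
  rw [coeff_sub, coeff_zero_eq_eval_zero (u ^ n), eval_pow, ← coeff_zero_eq_eval_zero, hu, one_pow,
    coeff_one_zero, sub_self]

end CompositionInverse

/-- The `k`-algebra `A` is the group algebra of a semidirect product of a cyclic group of order `N`,
generated by `g` and unipotent in `A`, and an abelian group `E` of order `e`, acting by the faithful
character `χ` on `(g - 1) / (g - 1) ^ 2`. -/
structure SkewGroupData {k : Type*} [Field k] {A : Type*} [Ring A] [Algebra k A] {E : Type*}
    [CommGroup E] [Fintype E] (e N : ℕ) (χ : E →* k) (U : E →* A) (g : A) : Prop where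
  card : Fintype.card E = e
  ne_zero : (e : k) ≠ 0
  injective : ∀ ζ, χ ζ = 1 → ζ = 1
  conj : ∀ ζ, ∃ n : ℕ, (n : k) = χ ζ ∧ U ζ * g = g ^ n * U ζ
  sub_one_pow : (g - 1) ^ N = 0
  span : Submodule.span k {a | ∃ (n : ℕ) (ζ : E), a = g ^ n * U ζ} = ⊤
  exists_coeff : ∃ Λ : A →ₗ[k] k, Λ 1 = 1 ∧ ∀ j < N, ∀ ζ, ζ ≠ 1 ∨ j ≠ 0 → Λ (g ^ j * U ζ) = 0
  one_lt : 1 < N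

namespace SkewGroupData

variable {k : Type*} [Field k] {A : Type*} [Ring A] [Algebra k A] {E : Type*} [CommGroup E]

lemma map_inv_mul_map (χ : E →* k) (ζ : E) : χ ζ⁻¹ * χ ζ = 1 := by
  rw [← map_mul, inv_mul_cancel, map_one]

variable [Fintype E] {e N : ℕ} {χ : E →* k} {U : E →* A} {g : A}

variable (χ U) in
/-- The idempotent of the character `χ ^ α` of `E`. -/
def idem (α : ZMod e) : A := (e : k)⁻¹ • ∑ ζ, χ ζ⁻¹ ^ α.val • U ζ

variable (e χ U g) in
/-- The homogeneous component of degree one of `g - 1`. -/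
def homog : A := (e : k)⁻¹ • ∑ ζ, χ ζ⁻¹ • (U ζ * (g - 1) * U ζ⁻¹)

lemma mul_idem (ζ : E) (α : ZMod e) : U ζ * idem χ U α = χ ζ ^ α.val • idem χ U α := by
  have h1 : U ζ * ∑ η, χ η⁻¹ ^ α.val • U η = χ ζ ^ α.val • ∑ η, χ η⁻¹ ^ α.val • U η := by
    rw [Finset.mul_sum, Finset.smul_sum]
    refine Fintype.sum_equiv (Equiv.mulLeft ζ) _ _ fun η => ?_
    rw [Equiv.coe_mulLeft, mul_smul_comm, ← map_mul, smul_smul, ← mul_pow, ← map_mul]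
    congr 3
    simp
  rw [idem, mul_smul_comm, smul_comm, h1]

lemma mul_homog (ζ : E) : U ζ * homog e χ U g = χ ζ • (homog e χ U g * U ζ) := by
  have h1 : U ζ * ∑ η, χ η⁻¹ • (U η * (g - 1) * U η⁻¹) =
      χ ζ • ((∑ η, χ η⁻¹ • (U η * (g - 1) * U η⁻¹)) * U ζ) := by
    rw [Finset.mul_sum, Finset.sum_mul, Finset.smul_sum]
    refine Fintype.sum_equiv (Equiv.mulLeft ζ) _ _ fun η => ?_
    have h2 : U (ζ * η)⁻¹ * U ζ = U η⁻¹ := by rw [← map_mul, mul_inv_rev, inv_mul_cancel_right]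
    have h3 : χ ζ * χ (ζ * η)⁻¹ = χ η⁻¹ := by
      rw [← map_mul, mul_inv, mul_inv_cancel_left]
    rw [Equiv.coe_mulLeft, mul_smul_comm, smul_mul_assoc, smul_smul, h3, mul_assoc _ _ (U ζ), h2,
      map_mul, mul_assoc (U ζ), mul_assoc (U ζ)]
  rw [homog, mul_smul_comm, smul_mul_assoc, smul_comm, h1]

lemma pow_eq_one (h : SkewGroupData e N χ U g) (ζ : E) : χ ζ ^ e = 1 := by
  rw [← map_pow, ← h.card, pow_card_eq_one, map_one]

lemma pow_natCast_val (h : SkewGroupData e N χ U g) (ζ : E) (n : ℕ) :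
    χ ζ ^ (n : ZMod e).val = χ ζ ^ n := by
  rw [ZMod.val_natCast, ← pow_eq_pow_mod n (h.pow_eq_one ζ)]

lemma pow_add_one_val [NeZero e] (h : SkewGroupData e N χ U g) (ζ : E) (α : ZMod e) :
    χ ζ ^ (α + 1).val = χ ζ ^ α.val * χ ζ := by
  rw [← pow_succ, ← h.pow_natCast_val ζ (α.val + 1), Nat.cast_succ, ZMod.natCast_zmod_val]

lemma sum_pow_val [NeZero e] (h : SkewGroupData e N χ U g) {ζ : E} (hζ : ζ ≠ 1) :
    ∑ α : ZMod e, χ ζ ^ α.val = 0 := by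
  have h1 : (∑ α : ZMod e, χ ζ ^ α.val) * χ ζ = ∑ α : ZMod e, χ ζ ^ α.val := by
    rw [Finset.sum_mul]
    exact Fintype.sum_equiv (Equiv.addRight 1) _ _ fun α => (h.pow_add_one_val ζ α).symm
  have h2 : (∑ α : ZMod e, χ ζ ^ α.val) * (χ ζ - 1) = 0 := by rw [mul_sub, h1, mul_one, sub_self]
  exact (mul_eq_zero.1 h2).resolve_right fun h3 => hζ (h.injective ζ (sub_eq_zero.1 h3))

/-- As `χ` embeds `E` into a field, `E` is cyclic. Translation by a generator multiplies the sum by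
a scalar `c`, and `c ≠ 1` because the generator has order `e`. -/
lemma sum_inv_pow_mul_pow [NeZero e] (h : SkewGroupData e N χ U g) {α β : ZMod e} (hαβ : α ≠ β) :
    ∑ ζ, χ ζ⁻¹ ^ α.val * χ ζ ^ β.val = 0 := by
  have hinj : Function.Injective χ := fun ζ η hζη => by
    rw [← div_eq_one]
    apply h.injective
    rw [div_eq_mul_inv, map_mul, hζη, ← map_mul, mul_inv_cancel, map_one]
  obtain ⟨γ, hγ⟩ := (isCyclic_of_injective_ringHom χ hinj).exists_generator
  have hord : orderOf γ = e := by
    rw [orderOf_eq_card_of_forall_mem_zpowers hγ, Nat.card_eq_fintype_card, h.card]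
  set c := χ γ⁻¹ ^ α.val * χ γ ^ β.val with hc
  have hc1 : c ≠ 1 := by
    intro hc1
    have h1 : χ γ ^ β.val = χ γ ^ α.val := by
      calc χ γ ^ β.val = (χ γ⁻¹ * χ γ) ^ α.val * χ γ ^ β.val := by
            rw [map_inv_mul_map, one_pow, one_mul]
        _ = c * χ γ ^ α.val := by rw [hc]; ring
        _ = χ γ ^ α.val := by rw [hc1, one_mul]
    rw [← map_pow, ← map_pow] at h1
    have h2 := pow_injOn_Iio_orderOf (by rw [Set.mem_Iio, hord]; exact ZMod.val_lt β)
      (by rw [Set.mem_Iio, hord]; exact ZMod.val_lt α) (hinj h1)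
    exact hαβ (ZMod.val_injective e h2.symm)
  have h1 : c * ∑ ζ, χ ζ⁻¹ ^ α.val * χ ζ ^ β.val = ∑ ζ, χ ζ⁻¹ ^ α.val * χ ζ ^ β.val := by
    rw [Finset.mul_sum]
    refine Fintype.sum_equiv (Equiv.mulLeft γ) _ _ fun ζ => ?_
    rw [Equiv.coe_mulLeft, mul_inv_rev, map_mul, map_mul, hc]
    ring
  have h2 : (c - 1) * ∑ ζ, χ ζ⁻¹ ^ α.val * χ ζ ^ β.val = 0 := by
    rw [sub_mul, h1, one_mul, sub_self]
  exact (mul_eq_zero.1 h2).resolve_left (sub_ne_zero.2 hc1)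

lemma sum_inv_pow_mul_pow_self (h : SkewGroupData e N χ U g) (α : ZMod e) :
    ∑ ζ, χ ζ⁻¹ ^ α.val * χ ζ ^ α.val = e := by
  simp_rw [← mul_pow, map_inv_mul_map, one_pow]
  rw [Finset.sum_const, Finset.card_univ, h.card, nsmul_one]

lemma idem_mul_idem (α β : ZMod e) : idem χ U α * idem χ U β =
    ((e : k)⁻¹ * ∑ ζ, χ ζ⁻¹ ^ α.val * χ ζ ^ β.val) • idem χ U β := by
  nth_rw 1 [idem]
  rw [smul_mul_assoc, Finset.sum_mul, mul_smul, Finset.sum_smul]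
  congr 1
  refine Finset.sum_congr rfl fun ζ _ => ?_
  rw [smul_mul_assoc, mul_idem, smul_smul]

lemma sum_idem [NeZero e] (h : SkewGroupData e N χ U g) : ∑ α : ZMod e, idem χ U α = 1 := by
  unfold idem
  rw [← Finset.smul_sum, Finset.sum_comm, Finset.sum_eq_single 1]
  · simp only [inv_one, map_one, one_pow, one_smul, Finset.sum_const, Finset.card_univ, ZMod.card]
    rw [← Nat.cast_smul_eq_nsmul k, smul_smul, inv_mul_cancel₀ h.ne_zero, one_smul]
  · intro ζ _ hζ
    rw [← Finset.sum_smul, h.sum_pow_val (inv_ne_one.2 hζ), zero_smul]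
  · simp

lemma idem_mul_homog [NeZero e] (h : SkewGroupData e N χ U g) (α : ZMod e) :
    idem χ U (α + 1) * homog e χ U g = homog e χ U g * idem χ U α := by
  unfold idem
  rw [smul_mul_assoc, mul_smul_comm, Finset.sum_mul, Finset.mul_sum]
  congr 1
  refine Finset.sum_congr rfl fun ζ _ => ?_
  rw [smul_mul_assoc, mul_homog, smul_smul, h.pow_add_one_val, mul_assoc, map_inv_mul_map, mul_one,
    mul_smul_comm]

/-- Conjugating `g - 1` by `ζ` gives `g ^ n - 1 = n (g - 1) + ⋯` with `n = χ ζ` in `k`. The twist by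
`χ ζ⁻¹` normalizes the linear coefficient to `1`, and averaging over `E` preserves it. -/
lemma exists_aeval_eq_homog (h : SkewGroupData e N χ U g) :
    ∃ F : k[X], F.coeff 0 = 0 ∧ F.coeff 1 = 1 ∧ homog e χ U g = aeval (g - 1) F := by
  choose n hn hconj using h.conj
  refine ⟨C (e : k)⁻¹ * ∑ ζ, C (χ ζ⁻¹) * ((X + 1) ^ n ζ - 1), ?_, ?_, ?_⟩
  · simp [coeff_X_add_one_pow]
  · have h1 : ∀ ζ, (C (χ ζ⁻¹) * ((X + 1) ^ n ζ - 1)).coeff 1 = 1 := fun ζ => by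
      rw [coeff_C_mul, coeff_sub, coeff_X_add_one_pow, Nat.choose_one_right, hn, coeff_one,
        if_neg one_ne_zero, sub_zero, map_inv_mul_map]
    rw [coeff_C_mul, finsetSum_coeff]
    simp_rw [h1]
    simp [h.card, h.ne_zero]
  · have hpow : ∀ ζ, U ζ * (g - 1) * U ζ⁻¹ = g ^ n ζ - 1 := fun ζ => by
      rw [mul_sub, hconj, mul_one, sub_mul, mul_assoc, ← map_mul, mul_inv_cancel, map_one, mul_one]
    simp_rw [homog, hpow, map_mul, map_sum, map_mul, aeval_C, ← Algebra.smul_def]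
    simp

lemma aeval_eq_of_dvd (h : SkewGroupData e N χ U g) {p q : k[X]} (hpq : X ^ N ∣ p - q) :
    aeval (g - 1) p = aeval (g - 1) q := by
  obtain ⟨r, hr⟩ := hpq
  rw [← sub_eq_zero, ← map_sub, hr, map_mul, map_pow, aeval_X, h.sub_one_pow, zero_mul]

/-- The polynomial `F` expressing `homog` in `g - 1` is invertible under composition modulo `X ^ N`,
so no polynomial in `g - 1` is lost. -/
lemma exists_aeval_homog (h : SkewGroupData e N χ U g) (q : k[X]) :
    ∃ p : k[X], aeval (g - 1) q = aeval (homog e χ U g) p := by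
  obtain ⟨F, h0, h1, hF⟩ := h.exists_aeval_eq_homog
  obtain ⟨p, hp⟩ := exists_X_pow_dvd_comp_sub h0 h1 q N
  refine ⟨p, ?_⟩
  rw [hF, ← aeval_comp, h.aeval_eq_of_dvd hp]

lemma homog_pow (h : SkewGroupData e N χ U g) {n : ℕ} (hn : N ≤ n + 1) :
    homog e χ U g ^ n = (g - 1) ^ n := by
  obtain ⟨F, h0, h1, hF⟩ := h.exists_aeval_eq_homog
  have h2 := h.aeval_eq_of_dvd ((pow_dvd_pow X hn).trans (X_pow_dvd_pow_sub h0 h1 n))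
  rwa [map_pow, map_pow, aeval_X, ← hF] at h2

lemma exists_mul_idem (h : SkewGroupData e N χ U g) (a : A) (α : ZMod e) :
    ∃ p : k[X], a * idem χ U α = aeval (homog e χ U g) p * idem χ U α := by
  have ha : a ∈ Submodule.span k {a | ∃ (n : ℕ) (ζ : E), a = g ^ n * U ζ} := by
    rw [h.span]
    trivial
  induction ha using Submodule.span_induction with
  | mem a ha =>
    obtain ⟨n, ζ, rfl⟩ := ha
    obtain ⟨p, hp⟩ := h.exists_aeval_homog ((X + 1) ^ n)
    refine ⟨C (χ ζ ^ α.val) * p, ?_⟩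
    rw [map_mul, ← hp, aeval_C, mul_assoc, mul_idem, mul_smul_comm, ← Algebra.smul_def,
      smul_mul_assoc]
    simp
  | zero => exact ⟨0, by simp⟩
  | add a b _ _ ha hb =>
    obtain ⟨p, hp⟩ := ha
    obtain ⟨q, hq⟩ := hb
    exact ⟨p + q, by rw [add_mul, hp, hq, map_add, add_mul]⟩
  | smul c a _ ha =>
    obtain ⟨p, hp⟩ := ha
    exact ⟨c • p, by rw [smul_mul_assoc, hp, map_smul, smul_mul_assoc]⟩

/-- The top powers of `homog` and `g - 1` agree. In the product with the idempotent, `Λ` sees only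
the term `j = 0`, `ζ = 1`, whose value `(-1) ^ (N - 1) / e` is nonzero. -/
lemma homog_pow_mul_idem_ne_zero (h : SkewGroupData e N χ U g) (α : ZMod e) :
    homog e χ U g ^ (N - 1) * idem χ U α ≠ 0 := by
  obtain ⟨Λ, hΛ1, hΛ⟩ := h.exists_coeff
  have h1N := h.one_lt
  set p : k[X] := (X - C 1) ^ (N - 1) with hp
  have h1 : (g - 1) ^ (N - 1) = aeval g p := by simp [hp]
  have hdeg : p.natDegree + 1 = N := by
    rw [hp, natDegree_pow, natDegree_X_sub_C, mul_one]
    omega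
  have h2 : Λ ((g - 1) ^ (N - 1) * idem χ U α) = p.coeff 0 * (e : k)⁻¹ := by
    rw [h1, aeval_eq_sum_range, hdeg, Finset.sum_mul, map_sum, Finset.sum_eq_single 0]
    · rw [idem, pow_zero, smul_mul_assoc, one_mul, map_smul, map_smul, map_sum,
        Finset.sum_eq_single 1]
      · simp [hΛ1]
      · intro ζ _ hζ
        have := hΛ 0 (by omega) ζ (Or.inl hζ)
        rw [pow_zero, one_mul] at this
        rw [map_smul, this, smul_zero]
      · simp
    · intro j hj hj0
      rw [Finset.mem_range] at hj
      rw [idem, smul_mul_assoc, mul_smul_comm, map_smul, map_smul, Finset.mul_sum, map_sum,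
        Finset.sum_eq_zero, smul_zero, smul_zero]
      intro ζ _
      rw [mul_smul_comm, map_smul, hΛ j hj ζ (Or.inr hj0), smul_zero]
    · intro h0
      exact absurd (Finset.mem_range.2 (by omega)) h0
  intro h0
  rw [h.homog_pow (by omega)] at h0
  rw [h0, map_zero, coeff_zero_eq_eval_zero, hp, eval_pow] at h2
  simp [h.ne_zero] at h2

/-- The group algebra of a semidirect product is a Nakayama algebra. -/
def nakayamaData [NeZero e] (h : SkewGroupData e N χ U g) : NakayamaData k A e N where
  x := homog e χ U g
  ε := idem χ U
  mul_self α := by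
    rw [idem_mul_idem, h.sum_inv_pow_mul_pow_self, inv_mul_cancel₀ h.ne_zero, one_smul]
  mul_of_ne α β hαβ := by rw [idem_mul_idem, h.sum_inv_pow_mul_pow hαβ, mul_zero, zero_smul]
  sum_eq_one := h.sum_idem
  shift := h.idem_mul_homog
  pow_eq_zero := by rw [h.homog_pow (Nat.le_succ N), h.sub_one_pow]
  exists_poly := h.exists_mul_idem
  pow_mul_ne_zero := h.homog_pow_mul_idem_ne_zero
  one_lt := h.one_lt

end SkewGroupData

/-! ### The group algebras of `ℤ/ℓ^a ⋊ E` and their simple modules -/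

lemma card_cycE (e : ℕ) [NeZero e] : Nat.card (CycE e) = e := by
  have h1 : IsPrimitiveRoot (⟨Complex.exp (2 * Real.pi * Complex.I / e),
      Algebra.subset_adjoin rfl⟩ : CycRing e) e :=
    IsPrimitiveRoot.coe_submonoidClass_iff.1 (Complex.isPrimitiveRoot_exp e (NeZero.ne e))
  exact h1.card_rootsOfUnity

instance finite_cycE (e : ℕ) [NeZero e] : Finite (CycE e) :=
  Nat.finite_of_card_ne_zero (by rw [card_cycE]; exact NeZero.ne e)

section

variable {e ℓ a : ℕ} (φ : CycRing e →+* ZMod (ℓ ^ a)) (k : Type u) [Field k]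

/-- The inclusion of `E` in the group algebra. -/
def ofCyc : CycE e →* GrpAlg φ k := (MonoidAlgebra.of k (Grp φ)).comp SemidirectProduct.inr

/-- The generator of `ℤ/ℓ^a`, in the group algebra. -/
def ofGen : GrpAlg φ k := MonoidAlgebra.of k (Grp φ) (SemidirectProduct.inl (Multiplicative.ofAdd 1))

lemma ofGen_pow (n : ℕ) : ofGen φ k ^ n =
    MonoidAlgebra.of k (Grp φ) (SemidirectProduct.inl (Multiplicative.ofAdd (n : ZMod (ℓ ^ a)))) := by
  rw [ofGen, ← map_pow, ← map_pow, ← ofAdd_nsmul, nsmul_one]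

variable {φ}

lemma inr_mul_inl (ζ : CycE e) (x : Multiplicative (ZMod (ℓ ^ a))) :
    (SemidirectProduct.inr ζ * SemidirectProduct.inl x : Grp φ) =
      SemidirectProduct.inl (action φ ζ x) * SemidirectProduct.inr ζ := by
  rw [SemidirectProduct.inl_aut, mul_assoc, ← map_mul, inv_mul_cancel, map_one, mul_one]

lemma action_ofAdd_one (ζ : CycE e) : action φ ζ (Multiplicative.ofAdd 1) =
    Multiplicative.ofAdd (φ ((ζ : (CycRing e)ˣ) : CycRing e)) := by
  rw [← mul_one (φ _)]
  rfl

end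

section

variable {e ℓ a : ℕ} [NeZero a] (φ : CycRing e →+* ZMod (ℓ ^ a)) (k : Type u) [Field k] [CharP k ℓ]

/-- The reduction of the tautological character of `E`. -/
def cycChar : CycE e →* k :=
  ((reduction φ k).toMonoidHom.comp (Units.coeHom (CycRing e))).comp (CycE e).subtype

variable {φ}

lemma smul_simpleMod (i : Fin e) (x : GrpAlg φ k) (c : k) :
    (x • (show simpleMod φ k i from c) : simpleMod φ k i) =
      (show simpleMod φ k i from (MonoidAlgebra.lift k k (Grp φ) (redChar φ k i) x * c)) := rfl

lemma lift_redChar_ofGen (i : ℕ) :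
    MonoidAlgebra.lift k k (Grp φ) (redChar φ k i) (ofGen φ k) = 1 := by
  rw [ofGen, MonoidAlgebra.lift_of]
  change cycChar φ k (SemidirectProduct.rightHom (φ := action φ)
    (SemidirectProduct.inl (Multiplicative.ofAdd 1))) ^ i = 1
  rw [SemidirectProduct.rightHom_inl, map_one, one_pow]

lemma lift_redChar_ofCyc (i : ℕ) (ζ : CycE e) :
    MonoidAlgebra.lift k k (Grp φ) (redChar φ k i) (ofCyc φ k ζ) = cycChar φ k ζ ^ i := by
  rw [ofCyc, MonoidHom.comp_apply, MonoidAlgebra.lift_of]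
  rfl

/-- If `z = φ ζ` is `1` modulo `ℓ`, its order divides `ℓ ^ a`; it also divides `e`, which is prime
to `ℓ ^ a`. So `z = 1`, and `φ` is injective on `E`. -/
lemma eq_one_of_cycChar_eq_one [NeZero e] (h : IsAdmissible e φ) (ζ : CycE e)
    (hζ : cycChar φ k ζ = 1) : ζ = 1 := by
  have hdvd : ℓ ∣ ℓ ^ a := dvd_pow_self ℓ (NeZero.ne a)
  set z : ZMod (ℓ ^ a) := φ ((ζ : (CycRing e)ˣ) : CycRing e) with hz
  have hze : z ^ e = 1 := by
    rw [hz, ← map_pow, ← Units.val_pow_eq_pow_val]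
    rw [(mem_rootsOfUnity e _).1 ζ.2, Units.val_one, map_one]
  obtain ⟨n, hn⟩ := ZMod.intCast_surjective z
  have h1 : (n : k) = 1 := by
    have : ZMod.castHom hdvd k z = 1 := hζ
    rwa [← hn, map_intCast] at this
  have h2 : (ℓ : ℤ) ∣ n - 1 := by
    rw [← CharP.intCast_eq_zero_iff k ℓ]
    push_cast
    rw [h1, sub_self]
  have h3 : z ^ ℓ ^ a = 1 := by
    have h4 := dvd_sub_pow_of_dvd_sub h2 a
    have h5 : ((n ^ ℓ ^ a - 1 ^ ℓ ^ a : ℤ) : ZMod (ℓ ^ a)) = 0 := by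
      rw [ZMod.intCast_zmod_eq_zero_iff_dvd]
      refine dvd_trans ?_ h4
      push_cast
      exact pow_dvd_pow _ (Nat.le_succ a)
    push_cast at h5
    rwa [hn, one_pow, sub_eq_zero] at h5
  have h4 : z = 1 := by
    rw [← orderOf_eq_one_iff]
    exact Nat.eq_one_of_dvd_coprimes h.coprime (orderOf_dvd_of_pow_eq_one hze)
      (orderOf_dvd_of_pow_eq_one h3)
  apply h.injOn
  rw [← hz, h4]
  simp

/-- For `k = ZMod ℓ` the reduced character embeds `E` into a group of order `ℓ - 1`. -/
lemma dvd_sub_one_of_isAdmissible [NeZero e] [Fact ℓ.Prime] (h : IsAdmissible e φ) : e ∣ ℓ - 1 := by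
  have h1 : Function.Injective (cycChar φ (ZMod ℓ)).toHomUnits := by
    rw [injective_iff_map_eq_one]
    intro ζ hζ
    exact eq_one_of_cycChar_eq_one (ZMod ℓ) h ζ (congrArg Units.val hζ)
  have h2 := Subgroup.card_dvd_of_injective _ h1
  rwa [card_cycE, Nat.card_eq_fintype_card, ZMod.card_units] at h2

lemma skewGroupData [NeZero e] [Fact ℓ.Prime] [Fintype (CycE e)] (h : IsAdmissible e φ) :
    SkewGroupData e (ℓ ^ a) (cycChar φ k) (ofCyc φ k) (ofGen φ k) where
  card := by rw [← Nat.card_eq_fintype_card, card_cycE]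
  ne_zero := by
    intro h0
    rw [CharP.cast_eq_zero_iff k ℓ] at h0
    exact (Fact.out : ℓ.Prime).one_lt.ne'
      (Nat.eq_one_of_dvd_coprimes h.coprime h0 (dvd_pow_self ℓ (NeZero.ne a)))
  injective := eq_one_of_cycChar_eq_one k h
  conj ζ := by
    have : NeZero (ℓ ^ a) := ⟨pow_ne_zero a (Fact.out : ℓ.Prime).ne_zero⟩
    refine ⟨(φ ((ζ : (CycRing e)ˣ) : CycRing e)).val, ?_, ?_⟩
    · change _ = ZMod.castHom (dvd_pow_self ℓ (NeZero.ne a)) k (φ ((ζ : (CycRing e)ˣ) : CycRing e))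
      nth_rw 2 [← ZMod.natCast_zmod_val (φ ((ζ : (CycRing e)ˣ) : CycRing e))]
      rw [map_natCast]
    · rw [ofGen_pow, ZMod.natCast_zmod_val, ← action_ofAdd_one, ofGen, ofCyc, MonoidHom.comp_apply,
        ← map_mul, ← map_mul, inr_mul_inl]
  sub_one_pow := by
    have h1 : ((X - 1 : k[X]) ^ ℓ ^ a) = X ^ ℓ ^ a - 1 := by
      rw [sub_pow_char_pow, one_pow]
    have h2 := congrArg (aeval (ofGen φ k)) h1
    rw [map_pow, map_sub, map_sub, map_pow, aeval_X, map_one, ofGen_pow, ZMod.natCast_self] at h2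
    rw [h2, ofAdd_zero, map_one, map_one, sub_self]
  span := by
    have : NeZero (ℓ ^ a) := ⟨pow_ne_zero a (Fact.out : ℓ.Prime).ne_zero⟩
    rw [eq_top_iff]
    rintro x -
    induction x using MonoidAlgebra.induction_on with
    | of g =>
      apply Submodule.subset_span
      refine ⟨(Multiplicative.toAdd g.left).val, g.right, ?_⟩
      rw [ofGen_pow, ZMod.natCast_zmod_val, ofAdd_toAdd, ofCyc, MonoidHom.comp_apply, ← map_mul,
        SemidirectProduct.inl_left_mul_inr_right]
    | add x y hx hy => exact Submodule.add_mem _ hx hy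
    | smul c x hx => exact Submodule.smul_mem _ c hx
  exists_coeff := by
    classical
    refine ⟨{ toFun := fun x => x.coeff 1, map_add' := fun _ _ => rfl, map_smul' := fun _ _ => rfl },
      ?_, fun j hj ζ hζ => ?_⟩
    · change (1 : GrpAlg φ k).coeff 1 = 1
      rw [MonoidAlgebra.one_def, MonoidAlgebra.coeff_single, Finsupp.single_apply, if_pos rfl]
    · change (ofGen φ k ^ j * ofCyc φ k ζ).coeff 1 = 0
      rw [ofGen_pow, ofCyc, MonoidHom.comp_apply, ← map_mul, MonoidAlgebra.of_apply,
        MonoidAlgebra.coeff_single, Finsupp.single_apply, if_neg]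
      intro h1
      have h2 := congrArg SemidirectProduct.right h1
      have h3 := congrArg SemidirectProduct.left h1
      simp only [SemidirectProduct.mul_right, SemidirectProduct.right_inl, one_mul,
        SemidirectProduct.right_inr, SemidirectProduct.one_right] at h2
      rcases hζ with hζ | hj0
      · exact hζ h2
      · rw [SemidirectProduct.mul_left, SemidirectProduct.left_inl, SemidirectProduct.left_inr,
          map_one, mul_one, SemidirectProduct.one_left, ← ofAdd_zero] at h3
        have h4 : (j : ZMod (ℓ ^ a)) = 0 := Multiplicative.ofAdd.injective h3
        rw [ZMod.natCast_eq_zero_iff] at h4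
        exact hj0 (Nat.eq_zero_of_dvd_of_lt h4 hj)
  one_lt := Nat.one_lt_pow (NeZero.ne a) (Fact.out : ℓ.Prime).one_lt

end

/-- The labelling of the characters of `E` by `ZMod e`. -/
def labelEquiv (e : ℕ) [NeZero e] : Fin e ≃ ZMod e where
  toFun i := ((i : ℕ) : ZMod e)
  invFun α := ⟨α.val, ZMod.val_lt α⟩
  left_inv i := Fin.ext (ZMod.val_natCast_of_lt i.2)
  right_inv α := ZMod.natCast_zmod_val α

section

variable {e ℓ a : ℕ} [NeZero a] {φ : CycRing e →+* ZMod (ℓ ^ a)} (k : Type u) [Field k] [CharP k ℓ]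
  [NeZero e] [Fact ℓ.Prime] [Fintype (CycE e)]

/-- Here `E` acts through `χ ^ i`, so the idempotent of label `i` acts as `1`. As `g` acts
trivially, `homog`, a polynomial in `g - 1` without constant term, acts as zero. -/
lemma isUni_simpleMod (h : IsAdmissible e φ) (i : Fin e) :
    (skewGroupData k h).nakayamaData.IsUni (labelEquiv e i) 1 (simpleMod φ k i) := by
  have hd := skewGroupData k h
  rw [NakayamaData.isUni_one_iff]
  refine ⟨(show simpleMod φ k i from (1 : k)), NakayamaData.IsGen.mk' _ ?_ ?_ ?_ ?_⟩
  · have h1 : MonoidAlgebra.lift k k (Grp φ) (redChar φ k i)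
        (SkewGroupData.idem (cycChar φ k) (ofCyc φ k) (labelEquiv e i)) = 1 := by
      rw [SkewGroupData.idem, map_smul, map_sum]
      simp_rw [map_smul, lift_redChar_ofCyc, smul_eq_mul, ← hd.pow_natCast_val _ (i : ℕ)]
      rw [labelEquiv, Equiv.coe_fn_mk, hd.sum_inv_pow_mul_pow_self, inv_mul_cancel₀ hd.ne_zero]
    refine (smul_simpleMod k i _ 1).trans ?_
    change MonoidAlgebra.lift k k (Grp φ) (redChar φ k i)
      (SkewGroupData.idem (cycChar φ k) (ofCyc φ k) (labelEquiv e i)) * 1 = (1 : k)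
    rw [h1, mul_one]
  · rw [eq_top_iff]
    rintro c -
    refine Submodule.mem_span_singleton.2 ⟨algebraMap k _ (show k from c), ?_⟩
    have h1 : ∀ c : k, MonoidAlgebra.lift k k (Grp φ) (redChar φ k i)
        (algebraMap k (GrpAlg φ k) c) * 1 = c := fun c => by
      rw [AlgHom.commutes, mul_one, Algebra.algebraMap_self_apply]
    exact h1 c
  · obtain ⟨F, h0, -, hF⟩ := hd.exists_aeval_eq_homog
    change MonoidAlgebra.lift k k (Grp φ) (redChar φ k i)
      (SkewGroupData.homog e (cycChar φ k) (ofCyc φ k) (ofGen φ k) ^ 1) * 1 = (0 : k)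
    rw [pow_one, mul_one, hF, ← aeval_algHom_apply, map_sub, lift_redChar_ofGen, map_one, sub_self,
      ← coeff_zero_eq_aeval_zero, h0]
  · intro _
    rw [Nat.sub_self, pow_zero, one_smul]
    exact one_ne_zero (α := k)

lemma isStandardLabelling_simpleMod (h : IsAdmissible e φ) : IsStandardLabelling (simpleMod φ k) := by
  have hT := isUni_simpleMod k h
  set D := (skewGroupData k h).nakayamaData
  -- The projective cover of `T 0` must have at least `e` layers for the labelling condition to make
  -- sense.
  have he : e ≤ ℓ ^ a := by
    have h1 := Nat.le_of_dvd (Nat.sub_pos_of_lt (Fact.out : ℓ.Prime).one_lt)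
      (dvd_sub_one_of_isAdmissible h)
    exact (h1.trans (Nat.sub_le _ _)).trans (Nat.le_self_pow (NeZero.ne a) ℓ)
  refine ⟨fun i => ?_, fun i j ⟨f⟩ => ?_, fun S hS => ?_, fun g x => ?_, ?_⟩
  · obtain ⟨v, hv⟩ := NakayamaData.isUni_one_iff.1 (hT i)
    exact hv.isSimpleModule
  · obtain ⟨v, hv⟩ := NakayamaData.isUni_one_iff.1 (hT i)
    obtain ⟨w, hw⟩ := NakayamaData.isUni_one_iff.1 (hT j)
    exact (labelEquiv e).injective ((hv.map_equiv f).unique hw one_ne_zero).1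
  · obtain ⟨τ, v, hv⟩ := NakayamaData.exists_isGen_of_isSimpleModule (D := D) (V := S)
    refine ⟨(labelEquiv e).symm τ, NakayamaData.IsUni.nonempty_equiv (s := τ)
      (NakayamaData.isUni_one_iff.2 ⟨v, hv⟩) ?_⟩
    have := hT ((labelEquiv e).symm τ)
    rwa [Equiv.apply_symm_apply] at this
  · change MonoidAlgebra.lift k k (Grp φ) (redChar φ k ((0 : Fin e) : ℕ))
      (MonoidAlgebra.of k (Grp φ) g) * (show k from x) = x
    rw [MonoidAlgebra.lift_of, Fin.val_zero]
    have h1 : redChar φ k 0 g = 1 := pow_zero _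
    rw [h1]
    exact one_mul (M := k) x
  · have hv := NakayamaData.isGen_ideal (D := D) (labelEquiv e 0)
    obtain ⟨w, hw⟩ := NakayamaData.isUni_one_iff.1 (hT 0)
    obtain ⟨f, hf⟩ := hv.exists_isProjectiveCover hw
    refine ⟨ModuleCat.of _ (Submodule.span _ {D.ε (labelEquiv e 0)}), f, hf, fun r => ?_⟩
    have hr := r.2
    have h1 := hv.subquot (r := r) (s := r + 1) (Nat.le_succ _) (by omega)
    rw [Nat.add_sub_cancel_left] at h1
    have h2 := (h1.isUni (s := labelEquiv e r) (by simp [labelEquiv])).nonempty_equiv (hT r)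
    rw [← hv.radPow_eq (r := r) (by omega), ← hv.radPow_eq (r := r + 1) (by omega)] at h2
    exact h2

end

/-! ### Projective types and Heller translates -/

section ProjectiveCover

variable {A : Type u} [Ring A]

lemma IsProjectiveCover.comp_equiv {Q M M' : Type*} [AddCommGroup Q] [Module A Q] [AddCommGroup M]
    [Module A M] [AddCommGroup M'] [Module A M'] {f : Q →ₗ[A] M} (hf : IsProjectiveCover f)
    (g : M ≃ₗ[A] M') : IsProjectiveCover (g.toLinearMap ∘ₗ f) where
  projective := hf.projective
  surjective := g.surjective.comp hf.surjective
  superfluous K hK := hf.superfluous K (by rwa [LinearEquiv.ker_comp] at hK)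

variable {ι : Type*} [DecidableEq ι] (T : ι → ModuleCat.{v} A)

/-- The embedding of `T α` in the direct sum of one copy of it. -/
def piSingle (α : ι) : T α →ₗ[A] ((β : ι) → Fin (Pi.single (M := fun _ => ℕ) α 1 β) → T β) :=
  LinearMap.pi fun β => LinearMap.pi fun _ =>
    LinearMap.proj β ∘ₗ LinearMap.single A (fun β => T β) α

lemma piSingle_apply (α : ι) (x : T α) (β : ι) (t : Fin (Pi.single (M := fun _ => ℕ) α 1 β)) :
    piSingle T α x β t = Pi.single (M := fun β => T β) α x β := rfl

lemma piSingle_bijective (α : ι) : Function.Bijective (piSingle T α) := by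
  have h1 : 0 < Pi.single (M := fun _ => ℕ) α 1 α := by simp
  constructor
  · intro x y hxy
    have h2 := congrFun (congrFun hxy α) ⟨0, h1⟩
    rwa [piSingle_apply, piSingle_apply, Pi.single_eq_same, Pi.single_eq_same] at h2
  · intro y
    refine ⟨y α ⟨0, h1⟩, funext fun β => funext fun t => ?_⟩
    rw [piSingle_apply]
    by_cases hβ : β = α
    · subst hβ
      rw [Pi.single_eq_same]
      congr 1
      have h2 := t.2
      simp only [Pi.single_eq_same] at h2
      exact Fin.ext (by simp only; omega)
    · have h2 := t.2
      simp [Pi.single_eq_of_ne hβ] at h2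

variable {T}

lemma IsProjectiveCover.isProjectiveOfType {α : ι} {Q : Type*} [AddCommGroup Q] [Module A Q]
    {f : Q →ₗ[A] T α} (hf : IsProjectiveCover f) : IsProjectiveOfType T (Pi.single α 1) Q :=
  ⟨_, hf.comp_equiv (LinearEquiv.ofBijective _ (piSingle_bijective T α))⟩

end ProjectiveCover

namespace NakayamaData

variable {k : Type*} [Field k] {A : Type u} [Ring A] [Algebra k A] {e N : ℕ} [NeZero e]
variable {D : NakayamaData k A e N}

/-- The projective cover of `V` is `A ε τ` with `τ = s - β + 1` the top of `V`. The kernel has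
length `N - β` and shares the socle of `A ε τ`, which is again `τ` since `N ≡ 1`. -/
lemma IsUni.exists_isOmega {s : ZMod e} {β : ℕ} {V : ModuleCat.{u} A} (h : D.IsUni s β V)
    (hβ : β ≠ 0) (hN : (N : ZMod e) = 1) :
    ∃ W : ModuleCat.{u} A, IsOmega V W ∧ D.IsUni (s - β + 1) (N - β) W := by
  obtain ⟨v, hv⟩ := h
  have hle := hv.le
  have hp := isGen_ideal (D := D) (s - β + 1)
  set p : Submodule.span A {D.ε (s - β + 1)} :=
    ⟨D.ε (s - β + 1), Submodule.mem_span_singleton_self _⟩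
  have h1 := hp.quotient hle
  obtain ⟨g, -⟩ := h1.exists_equiv hv
  have := hp.projective
  have hV : Nontrivial V := ⟨v, 0, hv.ne_zero hβ⟩
  have hf : IsProjectiveCover (g.toLinearMap ∘ₗ (D.layer p β).mkQ) :=
    isProjectiveCover_of_isUniserial hp.isUniserial _
      (g.surjective.comp (Submodule.mkQ_surjective _))
  have hk : LinearMap.ker (g.toLinearMap ∘ₗ (D.layer p β).mkQ) = D.layer p β := by
    rw [LinearEquiv.ker_comp, Submodule.ker_mkQ]
  refine ⟨ModuleCat.of A (D.layer p β), ⟨ModuleCat.of A _, _, hf,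
    ⟨LinearEquiv.ofEq _ _ hk.symm⟩⟩, ?_⟩
  refine (hp.sub hle).isUni ?_
  rw [Nat.cast_sub hle, hN]
  ring

variable {ι : Type*} {T : ι → ModuleCat.{u} A} {lab : ι ≃ ZMod e} {π : ι → ℕ} {i : ι}
  {X : CochainComplex (ModuleCat.{u} A) ℤ}

lemma exists_isProjectiveCover_of_isAlgorithmOutput (hT : ∀ i, D.IsUni (lab i) 1 (T i))
    (hN : (N : ZMod e) = 1) (heN : e < N) (hX : IsAlgorithmOutput T π i X) {j : ℕ} (hj : 1 ≤ j)
    (hjπ : j ≤ π i) : ∃ f : X.X (-(j : ℤ)) →ₗ[A]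
      T (lab.symm (run (π ∘ lab.symm) (lab i) (π i - j)).1), IsProjectiveCover f := by
  obtain ⟨v, hv, -⟩ := exists_isGen_of_isAlgorithmOutput hT hN heN hX (π i - j) j (by omega) hj
    _ _ _ rfl rfl rfl
  obtain ⟨w, hw⟩ := isUni_one_iff.1
    (hT (lab.symm (run (π ∘ lab.symm) (lab i) (π i - j)).1))
  rw [Equiv.apply_symm_apply] at hw
  exact hv.exists_isProjectiveCover hw

lemma isUni_degree_zero_of_even (hT : ∀ i, D.IsUni (lab i) 1 (T i))
    (hN : (N : ZMod e) = 1) (heN : e < N) (hX : IsAlgorithmOutput T π i X) (hπ : Even (π i)) :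
    D.IsUni (run (π ∘ lab.symm) (lab i) (π i)).1 (run (π ∘ lab.symm) (lab i) (π i)).2 (X.X 0) := by
  have h1 := isUni_degree_zero hT hN heN hX
  rwa [runLen, if_pos hπ] at h1

/-- The degree-zero term has length `N - b`, so `Ω` has length `b` and socle `s - (N - b) + 1 = s +
b`: both forget `N`. -/
lemma exists_isOmega_degree_zero_of_odd (hT : ∀ i, D.IsUni (lab i) 1 (T i))
    (hN : (N : ZMod e) = 1) (heN : e < N) (hX : IsAlgorithmOutput T π i X) (hπ : Odd (π i)) :
    ∃ W, IsOmega (X.X 0) W ∧ D.IsUni ((run (π ∘ lab.symm) (lab i) (π i)).1 +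
      (run (π ∘ lab.symm) (lab i) (π i)).2) (run (π ∘ lab.symm) (lab i) (π i)).2 W := by
  obtain ⟨-, h2, h3⟩ := run_spec (q := π ∘ lab.symm) (s₀ := lab i) (π i) (by simp)
  have h1 := isUni_degree_zero hT hN heN hX
  rw [runLen, if_neg (Nat.not_even_iff_odd.2 hπ)] at h1
  obtain ⟨W, hW, hW'⟩ := h1.exists_isOmega (by omega) hN
  refine ⟨W, hW, ?_⟩
  rw [Nat.sub_sub_self (by omega), Nat.cast_sub (by omega), hN] at hW'
  convert hW' using 1
  ring

end NakayamaData

section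

variable {e ℓ a : ℕ} [NeZero a] {φ : CycRing e →+* ZMod (ℓ ^ a)} [NeZero e] [Fact ℓ.Prime]

lemma cast_pow_of_isAdmissible (h : IsAdmissible e φ) : ((ℓ ^ a : ℕ) : ZMod e) = 1 := by
  have h1 := (ZMod.natCast_eq_zero_iff _ _).2 (dvd_sub_one_of_isAdmissible h)
  rw [Nat.cast_sub (Fact.out : ℓ.Prime).one_lt.le, sub_eq_zero, Nat.cast_one] at h1
  rw [Nat.cast_pow, h1, one_pow]

lemma lt_pow_of_isAdmissible (h : IsAdmissible e φ) : e < ℓ ^ a := by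
  have h0 := (Fact.out : ℓ.Prime).one_lt
  have h1 := Nat.le_of_dvd (Nat.sub_pos_of_lt h0) (dvd_sub_one_of_isAdmissible h)
  have h2 := Nat.le_self_pow (NeZero.ne a) ℓ
  omega

end

end PerverseAlg

end

theorem mainTheorem9 (e : ℕ) [NeZero e] (π : Fin e → ℕ) :
    IsGeneric.{u, v} e π 0 ∧
    ∀ (ℓ ℓ' a a' : ℕ) [Fact ℓ.Prime] [Fact ℓ'.Prime] [NeZero a] [NeZero a']
      (k : Type u) [Field k] [CharP k ℓ] (k' : Type v) [Field k'] [CharP k' ℓ']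
      (φ : CycRing e →+* ZMod (ℓ ^ a)) (φ' : CycRing e →+* ZMod (ℓ' ^ a')),
      e ∣ ℓ - 1 → e ∣ ℓ' - 1 → IsAdmissible e φ → IsAdmissible e φ' →
      -- the labellings of the simple modules, and the algorithm runs
      IsStandardLabelling (simpleMod φ k) ∧ IsStandardLabelling (simpleMod φ' k') ∧
      (∀ i, ∃ X, IsAlgorithmOutput (simpleMod φ k) π i X) ∧
      (∀ i, ∃ X', IsAlgorithmOutput (simpleMod φ' k') π i X') ∧
      ∀ (i : Fin e) (X : CochainComplex (ModuleCat.{u} (GrpAlg φ k)) ℤ)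
        (X' : CochainComplex (ModuleCat.{v} (GrpAlg φ' k')) ℤ),
        IsAlgorithmOutput (simpleMod φ k) π i X → IsAlgorithmOutput (simpleMod φ' k') π i X' →
        -- (i) the projective terms
        (∀ j : ℕ, 1 ≤ j → j ≤ π i → ∃ α : Fin e,
          (∃ f : X.X (-(j : ℤ)) →ₗ[GrpAlg φ k] simpleMod φ k α, IsProjectiveCover f) ∧
          (∃ f' : X'.X (-(j : ℤ)) →ₗ[GrpAlg φ' k'] simpleMod φ' k' α, IsProjectiveCover f')) ∧
        -- (ii) the cohomology
        (∀ j : ℕ, AreIdentified (simpleMod φ k) (simpleMod φ' k') 0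
          (X.homology (-(j : ℤ))) (X'.homology (-(j : ℤ)))) ∧
        -- (iii) the terms in degree zero
        (Even (π i) → AreIdentified (simpleMod φ k) (simpleMod φ' k') 1 (X.X 0) (X'.X 0)) ∧
        (Odd (π i) → ∃ (W : ModuleCat.{u} (GrpAlg φ k)) (W' : ModuleCat.{v} (GrpAlg φ' k')),
          IsOmega (X.X 0) W ∧ IsOmega (X'.X 0) W' ∧
          AreIdentified (simpleMod φ k) (simpleMod φ' k') 1 W W') := by
  have := Fintype.ofFinite (CycE e)
  constructor
  · intro ℓ ℓ' a a' _ _ _ _ k _ _ k' _ _ φ φ' h h' _ _ i X X' hX hX'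
    have hT := isUni_simpleMod k h
    have hT' := isUni_simpleMod k' h'
    -- One multiset serves both sides because `cohomologyLabel` depends only on `π` and the labels.
    refine ⟨fun j hj hjπ => ?_, fun j => ⟨_,
      (NakayamaData.isUni_homology hT (cast_pow_of_isAdmissible h) (lt_pow_of_isAdmissible h)
        hX j).hasCompositionFactors hT,
      (NakayamaData.isUni_homology hT' (cast_pow_of_isAdmissible h') (lt_pow_of_isAdmissible h')
        hX' j).hasCompositionFactors hT'⟩⟩
    obtain ⟨f, hf⟩ := NakayamaData.exists_isProjectiveCover_of_isAlgorithmOutput hT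
      (cast_pow_of_isAdmissible h) (lt_pow_of_isAdmissible h) hX hj hjπ
    obtain ⟨f', hf'⟩ := NakayamaData.exists_isProjectiveCover_of_isAlgorithmOutput hT'
      (cast_pow_of_isAdmissible h') (lt_pow_of_isAdmissible h') hX' hj hjπ
    exact ⟨_, hf.isProjectiveOfType, hf'.isProjectiveOfType⟩
  · intro ℓ ℓ' a a' _ _ _ _ k _ _ k' _ _ φ φ' _ _ h h'
    have hT := isUni_simpleMod k h
    have hT' := isUni_simpleMod k' h'
    have hN := cast_pow_of_isAdmissible h
    have hN' := cast_pow_of_isAdmissible h'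
    have heN := lt_pow_of_isAdmissible h
    have heN' := lt_pow_of_isAdmissible h'
    refine ⟨isStandardLabelling_simpleMod k h, isStandardLabelling_simpleMod k' h',
      NakayamaData.exists_isAlgorithmOutput _ hT hN heN π,
      NakayamaData.exists_isAlgorithmOutput _ hT' hN' heN' π, fun i X X' hX hX' => ?_⟩
    obtain ⟨-, h1, h2⟩ := run_spec (q := π ∘ (labelEquiv e).symm) (s₀ := labelEquiv e i) (π i)
      (by simp)
    -- Socles computed in `ZMod e` are rewritten as labels of simple modules, as required by
    -- `IsUni.isU`.
    have hlab : ∀ s : ZMod e, s = labelEquiv e ((labelEquiv e).symm s) := fun s =>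
      ((labelEquiv e).apply_symm_apply s).symm
    refine ⟨fun j hj hjπ => ⟨_,
      NakayamaData.exists_isProjectiveCover_of_isAlgorithmOutput hT hN heN hX hj hjπ,
      NakayamaData.exists_isProjectiveCover_of_isAlgorithmOutput hT' hN' heN' hX' hj hjπ⟩,
      fun j => ?_, fun hπ => ?_, fun hπ => ?_⟩
    · have h3 := NakayamaData.isUni_homology hT hN heN hX j
      have h3' := NakayamaData.isUni_homology hT' hN' heN' hX' j
      rw [hlab (cohomologyLabel _ _ _).1] at h3 h3'
      exact ⟨_, _, Nat.zero_le _, cohomologyLabel_le j, h3.isU hT, h3'.isU hT'⟩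
    · have h3 := NakayamaData.isUni_degree_zero_of_even hT hN heN hX hπ
      have h3' := NakayamaData.isUni_degree_zero_of_even hT' hN' heN' hX' hπ
      rw [hlab (run _ _ _).1] at h3 h3'
      exact ⟨_, _, h1, h2, h3.isU hT, h3'.isU hT'⟩
    · obtain ⟨W, hW, h3⟩ := NakayamaData.exists_isOmega_degree_zero_of_odd hT hN heN hX hπ
      obtain ⟨W', hW', h3'⟩ := NakayamaData.exists_isOmega_degree_zero_of_odd hT' hN' heN' hX' hπ
      rw [hlab ((run _ _ _).1 + _)] at h3 h3'
      exact ⟨W, W', hW, hW', _, _, h1, h2, h3.isU hT, h3'.isU hT'⟩
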